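/- **Setting.** Let $n\ge 2$ agents $N=\{1,\dots,n\}$ be the nodes of a strongly connected directed graph whose edges $(i,j)$ carry positive integer delays $d_{ij}$, and let $d^*\ge 1$ be its weighted diameter (the largest weighted shortest-path distance between two nodes). Let $$x(t+1)=Ax(t)+w(t),\qquad y_i(t)=C_ix(t)+v_i(t),\qquad t\ge 1,$$ with $x(1)\sim\mathcal N(0,\Sigma_x)$, $w(t)\sim\mathcal N(0,Q)$, $v_i(t)\sim\mathcal N(0,R_i)$. Agent $i$ knows at time $t$ $$I_i(t)=\{y_i(1),\dots,y_i(t)\}\cup\bigcup_{j:(j,i)\text{ edge}}I_j(t-d_{ji}),\qquad I_j(s)=\emptyset\ (s\le 0),$$ and produces $\hat z_i(t)=g_{i,t}(I_i(t))$ with $g_{i,t}$ measurable. For a horizon $T$ the cost of $g=(g_{i,t})$ is $$J_T(g)=\mathbb E\sum_{t=1}^T(Lx(t)-\hat z(t))^{\mathsf T}S(Lx(t)-\hat z(t))\in[0,\infty],$$ where $\hat z(t)$ stacks the $\hat z_i(t)$, $L=\mathrm{rows}(L_1,\dots,L_n)$ and $S=[S_{ij}]$. Assume (A1) $S$ is positive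 definite; (A2) all $R_i$ are positive definite, $Q$ and $\Sigma_x$ are positive semidefinite; (A3) $x(1)$, all $w(t)$ and all $v_i(t)$ ($t\ge1$) are mutually independent. **Notation.** Put $C=\mathrm{rows}(C_1,\dots,C_n)$, $R=\mathrm{diag}(R_1,\dots,R_n)$, $y(t)=\mathrm{vec}(y_1(t),\dots,y_n(t))$. Let $\hat x(1)=0$, $P(1)=\Sigma_x$, and for $t\ge 1$, with $K(t)=P(t)C^{\mathsf T}[CP(t)C^{\mathsf T}+R]^{-1}$ and $\Delta(t)=I-K(t)C$, $$\hat x(t+1)=A\hat x(t)+AK(t)[y(t)-C\hat x(t)],$$ $$P(t+1)=A\Delta(t)P(t)\Delta(t)^{\mathsf T}A^{\mathsf T}+AK(t)RK(t)^{\mathsf T}A^{\mathsf T}+Q.$$ Let $\tau=\tau(t)=\max\{1,t-d^*+1\}$ (so $t-\tau=d^*-1$ when $t\ge d^*$), $I^{com}(t)=\{y(1),\dots,y(t-d^*)\}$ (empty if $t\le d^*$), $I_i^{loc}(t)=I_i(t)\setminus I^{com}(t)$, and $\hat x^{com}(t)=A^{t-\tau}\hat x(\tau)$. Let $C_i^{loc}$,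 $w_i^{loc}(t)$, $v_i^{loc}(t)$ have, for each measurement $y_j(s)$ in $I_i^{loc}(t)$, the block $C_jA^{s-\tau}$, $C_j\sum_{r=\tau}^{s-1}A^{s-1-r}w(r)$, $v_j(s)$ respectively, so that $I_i^{loc}(t)=C_i^{loc}x(\tau)+w_i^{loc}(t)+v_i^{loc}(t)$. Let $\hat I_i^{loc}(t)=C_i^{loc}\hat x(\tau)$, $\tilde I_i^{loc}(t)=I_i^{loc}(t)-\hat I_i^{loc}(t)$, $w_0(t)=\sum_{s=\tau}^{t-1}A^{t-1-s}w(s)$, and $$\hat\Sigma_{ij}(t)=C_i^{loc}P(\tau)(C_j^{loc})^{\mathsf T}+\mathrm{Cov}(w_i^{loc}(t),w_j^{loc}(t))+\mathrm{Cov}(v_i^{loc}(t),v_j^{loc}(t)),$$ $$\hat\Theta_i(t)=A^{t-\tau}P(\tau)(C_i^{loc})^{\mathsf T}+\mathrm{Cov}(w_0(t),w_i^{loc}(t)),$$ $$P_0(t)=A^{t-\tau}P(\tau)(A^{t-\tau})^{\mathsf T}+\mathrm{Var}(w_0(t)).$$ Let $\Gamma(t)$ be the block matrix with blocks $\hat\Sigma_{ij}(t)\otimes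 S_{ij}$, and $\eta(t)=\mathrm{vec}(S_{1\bullet}L\hat\Theta_1(t),\dots,S_{n\bullet}L\hat\Theta_n(t))$, where $S_{i\bullet}$ is the $i$-th block row of $S$. **Theorem.** For $1\le t\le T$: 1. $I^{com}(t)\subseteq I_i(t)$ for all $i$. Almost surely $\hat x(\tau)=\mathbb E[x(\tau)\mid I^{com}(t)]$, $\hat x^{com}(t)=\mathbb E[x(t)\mid I^{com}(t)]$ and $\hat I_i^{loc}(t)=\mathbb E[I_i^{loc}(t)\mid I^{com}(t)]$. Moreover $\tilde I_i^{loc}(t)=C_i^{loc}(x(\tau)-\hat x(\tau))+w_i^{loc}(t)+v_i^{loc}(t)$, and $P(\tau)=\mathrm{Var}(x(\tau)-\hat x(\tau))$, $\hat\Sigma_{ij}(t)=\mathrm{Cov}(\tilde I_i^{loc}(t),\tilde I_j^{loc}(t))$, $\hat\Theta_i(t)=\mathrm{Cov}(x(t),\tilde I_i^{loc}(t))$, $P_0(t)=\mathrm{Var}(x(t)-\hat x^{com}(t))$. 2. The system $\sum_{j\in N}[S_{ij}F_j(t)\hat\Sigma_{ji}(t)-S_{ij}L_j\hat\Theta_i(t)]=0$,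 $i\in N$, has exactly one solution $(F_1(t),\dots,F_n(t))$; the matrix $\Gamma(t)$ is invertible, and $\mathrm{vec}(F_1(t),\dots,F_n(t))=\Gamma(t)^{-1}\eta(t)$. 3. With these gains, the minimum of $J_T$ is attained by a strategy with linear rules $g_{i,t}$, whose estimates are $$\hat z_i(t)=L_i\hat x^{com}(t)+F_i(t)\tilde I_i^{loc}(t),\qquad i\in N,\ 1\le t\le T.$$ A strategy minimizes $J_T$ if and only if its estimates are almost surely equal to these. 4. The minimum is finite and equals $$J_T^*=\sum_{t=1}^T\big[\mathrm{Tr}(L^{\mathsf T}SLP_0(t))-\eta(t)^{\mathsf T}\Gamma(t)^{-1}\eta(t)\big].$$ -/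

import Mathlib

open MeasureTheory ProbabilityTheory Matrix
open scoped ENNReal

noncomputable section

/-- A weighted directed graph on the agents `Fin n`: a set of ordered edges, where
`delay i j` is the communication delay, a positive integer, of the edge `(i, j)` from `i` to `j`
(its value at pairs which are not edges is never used). -/
structure CommGraph (n : ℕ) where
  edges : Finset (Fin n × Fin n)
  delay : Fin n → Fin n → ℕ
  delay_pos : ∀ i j, (i, j) ∈ edges → 0 < delay i j

namespace CommGraph

variable {n : ℕ} (G : CommGraph n)

/-- `l` is a directed path from `i` to `j`: a sequence of distinct nodes in which every two
consecutive nodes form an edge. -/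
def IsPath (i j : Fin n) (l : List (Fin n)) : Prop :=
  l.IsChain (fun a b => (a, b) ∈ G.edges) ∧ l.Nodup ∧ l.head? = some i ∧ l.getLast? = some j

/-- The weighted number of edges in a path. -/
def pathLength : List (Fin n) → ℕ
  | [] => 0
  | [_] => 0
  | a :: b :: l => G.delay a b + pathLength (b :: l)

/-- Every node can be reached from every node along a directed path. -/
def StronglyConnected : Prop := ∀ i j, ∃ l, G.IsPath i j l

/-- The geodesic distance: the least weighted length of all paths from `i` to `j`. -/
def dist (i j : Fin n) : ℕ := sInf {m | ∃ l, G.IsPath i j l ∧ G.pathLength l = m}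

/-- The weighted diameter `d*`: the largest geodesic distance between any two nodes. -/
def diam : ℕ := Finset.univ.sup fun p : Fin n × Fin n => G.dist p.1 p.2

/-- The information of agent `i` at time `t`, as a set of labels: `(j, s)` stands for the
measurement `y_j(s)`. It is given by
`I_i(t) = {y_i(1), …, y_i(t)} ∪ ⋃_{j in-neighbour of i} I_j(t - delay j i)`,
where `I_j` is empty at all times `≤ 0`. -/
def info (t : ℕ) (i : Fin n) : Finset (Fin n × ℕ) :=
  (Finset.Icc 1 t).image (fun s => (i, s)) ∪
    Finset.univ.biUnion fun j : Fin n =>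
      if _h : (j, i) ∈ G.edges ∧ G.delay j i ≤ t then info (t - G.delay j i) j else ∅
termination_by t
decreasing_by
  have := G.delay_pos j i _h.1
  have := _h.2
  omega

/-- The common information `I^com(t) = y(1 : t - d*)`, as a set of labels
(empty when `t ≤ d*`, by truncated subtraction). -/
def common (t : ℕ) : Finset (Fin n × ℕ) := Finset.univ ×ˢ Finset.Icc 1 (t - G.diam)

/-- The local information `I^loc_i(t) = I_i(t) \ I^com(t)`, as a set of labels. -/
def localInfo (t : ℕ) (i : Fin n) : Finset (Fin n × ℕ) := G.info t i \ G.common t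

/-- The time of the delayed state: `t - d* + 1`, and the initial time `1` if this is less
than `1`. (For `1 ≤ d*`, `t - (d* - 1)` is `t - d* + 1`.) -/
def delayedTime (t : ℕ) : ℕ := max 1 (t - (G.diam - 1))

end CommGraph

/-- The data of the filtering problem: `n` agents, a state in `ℝ^dx`, measurements `y_i` in
`ℝ^(dy i)`, estimates `ẑ_i` in `ℝ^(dz i)`. The index type `Σ i, Fin (dz i)` is that of the
stacked vector `ẑ = vec(ẑ_1, …, ẑ_n)`. -/
structure TeamModel (n dx : ℕ) (dy dz : Fin n → ℕ) where
  /-- the communication graph -/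
  G : CommGraph n
  /-- the dynamics -/
  A : Matrix (Fin dx) (Fin dx) ℝ
  /-- the measurement matrices -/
  C : (i : Fin n) → Matrix (Fin (dy i)) (Fin dx) ℝ
  /-- agent `i` estimates `L_i x(t)` -/
  L : (i : Fin n) → Matrix (Fin (dz i)) (Fin dx) ℝ
  /-- the weight matrix of the estimation error -/
  S : Matrix (Σ i, Fin (dz i)) (Σ i, Fin (dz i)) ℝ
  /-- the covariance of the initial state -/
  Sx : Matrix (Fin dx) (Fin dx) ℝ
  /-- the covariance of the process noise -/
  Q : Matrix (Fin dx) (Fin dx) ℝ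
  /-- the covariances of the measurement noises -/
  R : (i : Fin n) → Matrix (Fin (dy i)) (Fin (dy i)) ℝ

/-- The primitive random variables: the initial state `x(1)`, the process noise `w(t)` and the
measurement noises `v_i(t)`, where only the times `t ≥ 1` matter. -/
structure Primitives {n dx : ℕ} {dy dz : Fin n → ℕ} (M : TeamModel n dx dy dz)
    (Ω : Type*) where
  x1 : Ω → Fin dx → ℝ
  w : ℕ → Ω → Fin dx → ℝ
  v : (i : Fin n) → ℕ → Ω → Fin (dy i) → ℝ

/-- The labels of the primitive random variables: `init` is `x(1)`, `process t` is `w(t + 1)` and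
`noise i t` is `v_i(t + 1)`, for `t = 0, 1, …`. -/
inductive PrimitiveLabel (n : ℕ) where
  | init : PrimitiveLabel n
  | process (t : ℕ) : PrimitiveLabel n
  | noise (i : Fin n) (t : ℕ) : PrimitiveLabel n

/-- The dimension of a primitive random variable. -/
def PrimitiveLabel.dim {n : ℕ} (dx : ℕ) (dy : Fin n → ℕ) : PrimitiveLabel n → ℕ
  | .init => dx
  | .process _ => dx
  | .noise i _ => dy i

/-- The covariance matrix of two random vectors. -/
def covMat {Ω ι κ : Type*} [MeasurableSpace Ω] (μ : Measure Ω) (X : Ω → ι → ℝ)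
    (Y : Ω → κ → ℝ) : Matrix ι κ ℝ :=
  Matrix.of fun a b => cov[fun ω => X ω a, fun ω => Y ω b; μ]

namespace TeamModel

variable {n dx : ℕ} {dy dz : Fin n → ℕ} (M : TeamModel n dx dy dz)

/-- The block `S_ij` of the weight matrix. -/
def Sblock (i j : Fin n) : Matrix (Fin (dz i)) (Fin (dz j)) ℝ :=
  M.S.submatrix (fun a => ⟨i, a⟩) (fun b => ⟨j, b⟩)

/-- `L = rows(L_1, …, L_n)`. -/
def Lmat : Matrix (Σ i, Fin (dz i)) (Fin dx) ℝ := Matrix.of fun p => M.L p.1 p.2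

/-- `C = rows(C_1, …, C_n)`. -/
def Cmat : Matrix (Σ i, Fin (dy i)) (Fin dx) ℝ := Matrix.of fun p => M.C p.1 p.2

/-- `R = diag(R_1, …, R_n)`. -/
def Rmat : Matrix (Σ i, Fin (dy i)) (Σ i, Fin (dy i)) ℝ := Matrix.blockDiagonal' M.R

/-- The Kalman gain `P Cᵀ (C P Cᵀ + R)⁻¹` for an error covariance `P`. -/
def gainOf (P : Matrix (Fin dx) (Fin dx) ℝ) : Matrix (Fin dx) (Σ i, Fin (dy i)) ℝ :=
  P * M.Cmatᵀ * (M.Cmat * P * M.Cmatᵀ + M.Rmat)⁻¹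

/-- The forward Riccati recursion for the error covariance, which starts at time `1`
(the value at time `0` is not used): with `K = gainOf P` and `Δ = 1 - K C`, the next matrix is
`A Δ P Δᵀ Aᵀ + A K R Kᵀ Aᵀ + Q`. -/
def P : ℕ → Matrix (Fin dx) (Fin dx) ℝ
  | 0 => 0
  | 1 => M.Sx
  | t + 2 =>
      M.A * (1 - M.gainOf (P (t + 1)) * M.Cmat) * P (t + 1) *
          (1 - M.gainOf (P (t + 1)) * M.Cmat)ᵀ * M.Aᵀ
        + M.A * M.gainOf (P (t + 1)) * M.Rmat * (M.gainOf (P (t + 1)))ᵀ * M.Aᵀ + M.Q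

/-- The Kalman gain `K(t)`. -/
def K (t : ℕ) : Matrix (Fin dx) (Σ i, Fin (dy i)) ℝ := M.gainOf (M.P t)

/-- The values of the random vector `I_i(t)`. -/
abbrev InfoSpace (t : ℕ) (i : Fin n) : Type :=
  (p : M.G.info t i) → Fin (dy p.1.1) → ℝ

/-- The values of the random vector `I^com(t)`. -/
abbrev CommonSpace (t : ℕ) : Type :=
  (p : M.G.common t) → Fin (dy p.1.1) → ℝ

/-- The index type of the coordinates of the random vector `I^loc_i(t)`. -/
abbrev LocIdx (t : ℕ) (i : Fin n) : Type := Σ p : M.G.localInfo t i, Fin (dy p.1.1)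

/-- The matrix `C^loc_i`, the row block of which at the measurement `y_j(s)` is `C_j A^(s - τ)`,
where `τ` is the time of the delayed state. -/
def Cloc (t : ℕ) (i : Fin n) : Matrix (M.LocIdx t i) (Fin dx) ℝ :=
  Matrix.of fun q => (M.C q.1.1.1 * M.A ^ (q.1.1.2 - M.G.delayedTime t)) q.2

/-- A team estimation strategy profile: the measurable rules `g_{i,t}`. -/
structure Strategy where
  rule : (i : Fin n) → (t : ℕ) → M.InfoSpace t i → Fin (dz i) → ℝ
  measurable_rule : ∀ i t, Measurable (rule i t)

/-- The estimation error `(L x - z)ᵀ S (L x - z)`, where `z` is the stacked vector of the `z_i`. -/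
def cost (x : Fin dx → ℝ) (z : (i : Fin n) → Fin (dz i) → ℝ) : ℝ :=
  (M.Lmat *ᵥ x - fun p => z p.1 p.2) ⬝ᵥ (M.S *ᵥ (M.Lmat *ᵥ x - fun p => z p.1 p.2))

/-- The gains `F_1, …, F_n` at time `t`. -/
abbrev Gains (t : ℕ) : Type := (i : Fin n) → Matrix (Fin (dz i)) (M.LocIdx t i) ℝ

/-- The index type of `vec(F_1, …, F_n)`; each `F_i` is vectorized column by column. -/
abbrev VecIdx (t : ℕ) : Type := Σ i : Fin n, M.LocIdx t i × Fin (dz i)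

/-- `vec(F_1, …, F_n)`. -/
def vecGains {t : ℕ} (F : M.Gains t) : M.VecIdx t → ℝ := fun p => (F p.1).vec p.2

end TeamModel

namespace Primitives

variable {n dx : ℕ} {dy dz : Fin n → ℕ} {M : TeamModel n dx dy dz} {Ω : Type*}
  (X : Primitives M Ω)

/-- All primitive random variables as one family. -/
def toFamily : (k : PrimitiveLabel n) → Ω → Fin (k.dim dx dy) → ℝ
  | .init => X.x1
  | .process t => X.w (t + 1)
  | .noise i t => X.v i (t + 1)

/-- The state: `x(t + 1) = A x(t) + w(t)` for `t ≥ 1` (the value at time `0` is not used). -/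
def x : ℕ → Ω → Fin dx → ℝ
  | 0, _ => 0
  | 1, ω => X.x1 ω
  | t + 2, ω => M.A *ᵥ x (t + 1) ω + X.w (t + 1) ω

/-- The measurements `y_i(t) = C_i x(t) + v_i(t)`. -/
def y (i : Fin n) (t : ℕ) (ω : Ω) : Fin (dy i) → ℝ := M.C i *ᵥ X.x t ω + X.v i t ω

/-- `y(t) = vec(y_1(t), …, y_n(t))`. -/
def yAll (t : ℕ) (ω : Ω) : (Σ i, Fin (dy i)) → ℝ := fun p => X.y p.1 t ω p.2

/-- The centralized Kalman one-step predictor: `x̂(1) = 0` and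
`x̂(t + 1) = A x̂(t) + A K(t) (y(t) - C x̂(t))` for `t ≥ 1` (the value at time `0` is not used). -/
def xhat : ℕ → Ω → Fin dx → ℝ
  | 0, _ => 0
  | 1, _ => 0
  | t + 2, ω => M.A *ᵥ xhat (t + 1) ω +
      (M.A * M.K (t + 1)) *ᵥ (X.yAll (t + 1) ω - M.Cmat *ᵥ xhat (t + 1) ω)

/-- The random vector `I_i(t)`. -/
def infoVec (t : ℕ) (i : Fin n) (ω : Ω) : M.InfoSpace t i := fun p => X.y p.1.1 p.1.2 ω

/-- The random vector `I^com(t)`. -/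
def commonVec (t : ℕ) (ω : Ω) : M.CommonSpace t := fun p => X.y p.1.1 p.1.2 ω

/-- The σ-algebra generated by the common information. -/
abbrev commonSigma (t : ℕ) : MeasurableSpace Ω := MeasurableSpace.comap (X.commonVec t) inferInstance

/-- The random vector `I^loc_i(t)`. -/
def locVec (t : ℕ) (i : Fin n) (ω : Ω) : M.LocIdx t i → ℝ :=
  fun q => X.y q.1.1.1 q.1.1.2 ω q.2

/-- The common estimate `x̂^com(t) = A^(t - τ) x̂(τ)`, where `τ` is the time of the delayed state;
here `τ = t - d* + 1` and `t - τ = d* - 1` as soon as `t ≥ d*`. -/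
def xcom (t : ℕ) (ω : Ω) : Fin dx → ℝ :=
  M.A ^ (t - M.G.delayedTime t) *ᵥ X.xhat (M.G.delayedTime t) ω

/-- The error `x̃(τ) = x(τ) - x̂(τ)` of the delayed state estimate. -/
def xtilde (t : ℕ) (ω : Ω) : Fin dx → ℝ :=
  X.x (M.G.delayedTime t) ω - X.xhat (M.G.delayedTime t) ω

/-- The common estimate `Î^loc_i(t) = C^loc_i x̂(τ)` of the local information. -/
def locHat (t : ℕ) (i : Fin n) (ω : Ω) : M.LocIdx t i → ℝ :=
  M.Cloc t i *ᵥ X.xhat (M.G.delayedTime t) ω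

/-- The local innovation `Ĩ^loc_i(t) = I^loc_i(t) - Î^loc_i(t)`. -/
def locTilde (t : ℕ) (i : Fin n) (ω : Ω) : M.LocIdx t i → ℝ :=
  X.locVec t i ω - X.locHat t i ω

/-- `w^(k)(ℓ, t) = ∑_{s = max(1, t - k)}^{t - ℓ - 1} A^(t - ℓ - s - 1) w(s)`. -/
def wsum (k l t : ℕ) (ω : Ω) : Fin dx → ℝ :=
  ∑ s ∈ Finset.Icc (max 1 (t - k)) (t - l - 1), M.A ^ (t - l - s - 1) *ᵥ X.w s ω

/-- The vector `w^loc_i(t)`, the block of which at `y_j(s)` is `C_j w^(d* - 1)(t - s, t)`. -/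
def wloc (t : ℕ) (i : Fin n) (ω : Ω) : M.LocIdx t i → ℝ :=
  fun q => (M.C q.1.1.1 *ᵥ X.wsum (M.G.diam - 1) (t - q.1.1.2) t ω) q.2

/-- The vector `v^loc_i(t)`, the block of which at `y_j(s)` is `v_j(s)`. -/
def vloc (t : ℕ) (i : Fin n) (ω : Ω) : M.LocIdx t i → ℝ :=
  fun q => X.v q.1.1.1 q.1.1.2 ω q.2

variable [MeasurableSpace Ω] (μ : Measure Ω)

/-- `Σ̂_ij(t) = C^loc_i P(τ) (C^loc_j)ᵀ + P^w_ij(t) + P^v_ij(t)`, where `P^w_ij(t)` and `P^v_ij(t)`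
are the covariances of `w^loc_i(t)`, `w^loc_j(t)` and of `v^loc_i(t)`, `v^loc_j(t)`. -/
def SigmaHat (t : ℕ) (i j : Fin n) : Matrix (M.LocIdx t i) (M.LocIdx t j) ℝ :=
  M.Cloc t i * M.P (M.G.delayedTime t) * (M.Cloc t j)ᵀ
    + covMat μ (X.wloc t i) (X.wloc t j) + covMat μ (X.vloc t i) (X.vloc t j)

/-- `Θ̂_i(t) = A^(t - τ) P(τ) (C^loc_i)ᵀ + P^σ_i(t)`, where `P^σ_i(t)` is the covariance of
`w^(d* - 1)(0, t)` and `w^loc_i(t)`. -/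
def ThetaHat (t : ℕ) (i : Fin n) : Matrix (Fin dx) (M.LocIdx t i) ℝ :=
  M.A ^ (t - M.G.delayedTime t) * M.P (M.G.delayedTime t) * (M.Cloc t i)ᵀ
    + covMat μ (X.wsum (M.G.diam - 1) 0 t) (X.wloc t i)

/-- `P_0(t) = A^(t - τ) P(τ) (A^(t - τ))ᵀ + Σ^w(t)`, where `Σ^w(t)` is the variance of
`w^(d* - 1)(0, t)`. -/
def P0 (t : ℕ) : Matrix (Fin dx) (Fin dx) ℝ :=
  M.A ^ (t - M.G.delayedTime t) * M.P (M.G.delayedTime t) * (M.A ^ (t - M.G.delayedTime t))ᵀ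
    + covMat μ (X.wsum (M.G.diam - 1) 0 t) (X.wsum (M.G.diam - 1) 0 t)

/-- The system of matrix equations for the gains at time `t`:
`∑_j [S_ij F_j Σ̂_ji(t) - S_ij L_j Θ̂_i(t)] = 0` for all `i`. -/
def GainEquations (t : ℕ) (F : M.Gains t) : Prop :=
  ∀ i, ∑ j, (M.Sblock i j * F j * X.SigmaHat μ t j i
    - M.Sblock i j * M.L j * X.ThetaHat μ t i) = 0

/-- `Γ(t)`, the block matrix with the blocks `Σ̂_ij(t) ⊗ S_ij`. -/
def Gam (t : ℕ) : Matrix (M.VecIdx t) (M.VecIdx t) ℝ :=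
  Matrix.of fun p q => Matrix.kronecker (X.SigmaHat μ t p.1 q.1) (M.Sblock p.1 q.1) p.2 q.2

/-- `η(t) = vec(S_{1•} L Θ̂_1(t), …, S_{n•} L Θ̂_n(t))`, where `S_{i•}` is the `i`-th block row. -/
def eta (t : ℕ) : M.VecIdx t → ℝ :=
  M.vecGains fun i => M.S.submatrix (fun a : Fin (dz i) => (⟨i, a⟩ : Σ i, Fin (dz i))) id * M.Lmat * X.ThetaHat μ t i

/-- The estimates `ẑ_i(t) = g_{i,t}(I_i(t))`. -/
def estimate (g : M.Strategy) (i : Fin n) (t : ℕ) (ω : Ω) : Fin (dz i) → ℝ :=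
  g.rule i t (X.infoVec t i ω)

/-- The team mean-squared error `J_T(g) = E[∑_{t = 1}^T c(x(t), ẑ(t))]`, which may be infinite. -/
def J (T : ℕ) (g : M.Strategy) : ℝ≥0∞ :=
  ∫⁻ ω, ENNReal.ofReal
    (∑ t ∈ Finset.Icc 1 T, M.cost (X.x t ω) fun i => X.estimate g i t ω) ∂μ

end Primitives

end

/-! The estimates do not influence the state, so the cost splits over time into static quadratic
team problems. The theorem is the projection theorem for each of them, in a form that allows
infinite costs.

All states, measurements and predictors are linear combinations of the independent centred Gaussian
primitives. They are thus jointly Gaussian, and in their span uncorrelated means independent. The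
Kalman prediction error is uncorrelated with the earlier measurements (`covMat_err_yAll`), by the
normal equation of the gain (`K_mul`) and induction on time. A measurement reaches every agent
within `d*` steps along a shortest path (`common_subset_info`). The information of agent `i`
therefore consists of the common measurements before `τ`, summarized by the predictor at `τ`, and of
local ones in the window from `τ` to `t`. The local innovations depend only on the prediction error
at `τ` and on noises from `τ` on. This gives the covariance formulas and makes the innovations
uncorrelated with the common measurements.

Let `e` be the stacked error of the estimates `L_i x̂^com + F_i Ĩ_i`. The `i`-th gain equation says
that `S_{i•} e` is uncorrelated with the innovation of agent `i` (`covMat_linErr_locTilde`). With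
respect to common measurements this holds for all gains. Hence `S_{i•} e` is independent of the
whole of `I_i(t)` (`indepFun_linErr_infoVec`), and `S e` is orthogonal to every square-integrable
deviation formed agentwise from the available information, linear or not. By Pythagoras the cost of
any strategy is that of the linear one plus the `S`-cost of the deviation (`lintegral_cost`,
`J_eq_add`), which vanishes only for an almost surely zero deviation. This yields optimality,
uniqueness and the value.

The gains exist and are unique because `Γ` is invertible (`isUnit_det_Gam`): `fᵀ Γ f` is the
`S`-cost of the team deviation with gains `f`, and every `Σ̂_ii` is positive definite owing to the
measurement noise. -/

noncomputable section

/-! ### Covariance matrices -/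

section CovMat

variable {Ω ι κ ξ : Type*}

/-- All coordinates of the random vector `Y` lie in the space `V` of random variables. -/
def VecMem (V : Submodule ℝ (Ω → ℝ)) (Y : Ω → ι → ℝ) : Prop := ∀ a, (fun ω => Y ω a) ∈ V

namespace VecMem

variable {V W : Submodule ℝ (Ω → ℝ)} {Y Z : Ω → ι → ℝ}

lemma mono (h : VecMem V Y) (hVW : V ≤ W) : VecMem W Y := fun a => hVW (h a)

lemma zero : VecMem V (fun _ => (0 : ι → ℝ)) := fun _ => V.zero_mem

lemma add (hY : VecMem V Y) (hZ : VecMem V Z) : VecMem V (fun ω => Y ω + Z ω) :=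
  fun a => V.add_mem (hY a) (hZ a)

lemma sub (hY : VecMem V Y) (hZ : VecMem V Z) : VecMem V (fun ω => Y ω - Z ω) :=
  fun a => V.sub_mem (hY a) (hZ a)

lemma sum {β : Type*} {s : Finset β} {Y : β → Ω → ι → ℝ} (h : ∀ b ∈ s, VecMem V (Y b)) :
    VecMem V (fun ω => ∑ b ∈ s, Y b ω) := fun a => by
  have : (fun ω => (∑ b ∈ s, Y b ω) a) = ∑ b ∈ s, fun ω => Y b ω a := by
    ext ω; simp
  rw [this]
  exact V.sum_mem fun b hb => h b hb a

lemma mulVec [Fintype ι] (B : Matrix κ ι ℝ) (hY : VecMem V Y) :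
    VecMem V (fun ω => B *ᵥ Y ω) := fun a => by
  have : (fun ω => (B *ᵥ Y ω) a) = ∑ b, B a b • fun ω => Y ω b := by
    ext ω; simp [Matrix.mulVec, dotProduct]
  rw [this]
  exact V.sum_mem fun b _ => V.smul_mem _ (hY b)

end VecMem

variable [MeasurableSpace Ω] {μ : Measure Ω}

/-- All coordinates of the random vector `Y` are square-integrable. -/
def SqIntegrable (μ : Measure Ω) (Y : Ω → ι → ℝ) : Prop := ∀ a, MemLp (fun ω => Y ω a) 2 μ

lemma SqIntegrable.add {Y Z : Ω → ι → ℝ} (hY : SqIntegrable μ Y) (hZ : SqIntegrable μ Z) :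
    SqIntegrable μ (fun ω => Y ω + Z ω) := fun a => (hY a).add (hZ a)

lemma SqIntegrable.sub {Y Z : Ω → ι → ℝ} (hY : SqIntegrable μ Y) (hZ : SqIntegrable μ Z) :
    SqIntegrable μ (fun ω => Y ω - Z ω) := fun a => (hY a).sub (hZ a)

lemma SqIntegrable.mulVec [Fintype ι] {Y : Ω → ι → ℝ} (B : Matrix κ ι ℝ)
    (hY : SqIntegrable μ Y) : SqIntegrable μ (fun ω => B *ᵥ Y ω) :=
  fun a => memLp_finsetSum (f := fun b ω => B a b * Y ω b) Finset.univ
    fun b _ => (hY b).const_mul (B a b)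

lemma covMat_apply (Y : Ω → ι → ℝ) (Z : Ω → κ → ℝ) (a : ι) (b : κ) :
    covMat μ Y Z a b = cov[fun ω => Y ω a, fun ω => Z ω b; μ] := rfl

lemma covMat_transpose (Y : Ω → ι → ℝ) (Z : Ω → κ → ℝ) :
    (covMat μ Y Z)ᵀ = covMat μ Z Y := by
  ext a b
  exact covariance_comm _ _

variable [IsFiniteMeasure μ]

lemma covMat_add_left {Y Y' : Ω → ι → ℝ} {Z : Ω → κ → ℝ} (hY : SqIntegrable μ Y)
    (hY' : SqIntegrable μ Y') (hZ : SqIntegrable μ Z) :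
    covMat μ (fun ω => Y ω + Y' ω) Z = covMat μ Y Z + covMat μ Y' Z := by
  ext a b
  exact covariance_add_left (hY a) (hY' a) (hZ b)

lemma covMat_sub_left {Y Y' : Ω → ι → ℝ} {Z : Ω → κ → ℝ} (hY : SqIntegrable μ Y)
    (hY' : SqIntegrable μ Y') (hZ : SqIntegrable μ Z) :
    covMat μ (fun ω => Y ω - Y' ω) Z = covMat μ Y Z - covMat μ Y' Z := by
  ext a b
  exact covariance_sub_left (hY a) (hY' a) (hZ b)

lemma covMat_add_right {Y Y' : Ω → ι → ℝ} {Z : Ω → κ → ℝ} (hY : SqIntegrable μ Y)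
    (hY' : SqIntegrable μ Y') (hZ : SqIntegrable μ Z) :
    covMat μ Z (fun ω => Y ω + Y' ω) = covMat μ Z Y + covMat μ Z Y' := by
  ext a b
  exact covariance_add_right (hZ a) (hY b) (hY' b)

lemma covMat_sub_right {Y Y' : Ω → ι → ℝ} {Z : Ω → κ → ℝ} (hY : SqIntegrable μ Y)
    (hY' : SqIntegrable μ Y') (hZ : SqIntegrable μ Z) :
    covMat μ Z (fun ω => Y ω - Y' ω) = covMat μ Z Y - covMat μ Z Y' := by
  ext a b
  exact covariance_sub_right (hZ a) (hY b) (hY' b)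

lemma covMat_mulVec_left [Fintype ι] {Y : Ω → ι → ℝ} {Z : Ω → κ → ℝ} (B : Matrix ξ ι ℝ)
    (hY : SqIntegrable μ Y) (hZ : SqIntegrable μ Z) :
    covMat μ (fun ω => B *ᵥ Y ω) Z = B * covMat μ Y Z := by
  ext a b
  simp only [covMat_apply, Matrix.mul_apply]
  refine (covariance_fun_sum_left (X := fun c ω => B a c * Y ω c)
    (fun c => (hY c).const_mul _) (hZ b)).trans ?_
  exact Finset.sum_congr rfl fun c _ => covariance_const_mul_left _

lemma covMat_mulVec_right [Fintype ι] {Y : Ω → ι → ℝ} {Z : Ω → κ → ℝ} (B : Matrix ξ ι ℝ)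
    (hY : SqIntegrable μ Y) (hZ : SqIntegrable μ Z) :
    covMat μ Z (fun ω => B *ᵥ Y ω) = covMat μ Z Y * Bᵀ := by
  rw [← covMat_transpose, covMat_mulVec_left B hY hZ, Matrix.transpose_mul, covMat_transpose]

/-- The quadratic form at `f` is the variance of the linear combination with coefficients `f`. -/
lemma covMat_posSemidef [Fintype ι] {Y : Ω → ι → ℝ} (hY : SqIntegrable μ Y) :
    (covMat μ Y Y).PosSemidef := by
  refine Matrix.PosSemidef.of_dotProduct_mulVec_nonneg ?_ fun f => ?_
  · rw [Matrix.IsHermitian, Matrix.conjTranspose_eq_transpose_of_trivial, covMat_transpose]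
  · have h : f ⬝ᵥ (covMat μ Y Y *ᵥ f) = Var[fun ω => ∑ a, f a * Y ω a; μ] := by
      rw [← covariance_self (Finset.aemeasurable_fun_sum _ fun a _ =>
        (hY a).aestronglyMeasurable.aemeasurable.const_mul _),
        covariance_fun_sum_fun_sum (fun a => (hY a).const_mul _) (fun a => (hY a).const_mul _)]
      simp only [dotProduct, Matrix.mulVec, covariance_const_mul_left,
        covariance_const_mul_right, Finset.mul_sum, covMat_apply]
      exact Finset.sum_congr rfl fun a _ => Finset.sum_congr rfl fun b _ => by ring
    simp [h, variance_nonneg]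

end CovMat

/-! ### Positive definite matrices -/

/-- A positive semidefinite block diagonal matrix with positive definite blocks is positive
definite. -/
lemma Matrix.PosSemidef.posDef_blockDiagonal' {o : Type*} [Fintype o] [DecidableEq o]
    {m : o → Type*} [∀ i, Fintype (m i)] [∀ i, DecidableEq (m i)]
    {B : (i : o) → Matrix (m i) (m i) ℝ} (h : (blockDiagonal' B).PosSemidef)
    (hB : ∀ i, (B i).PosDef) : (blockDiagonal' B).PosDef := by
  -- For a semidefinite matrix, definiteness is invertibility, which can be checked block by block.
  refine h.posDef_iff_isUnit.2 (IsUnit.of_mul_eq_one (blockDiagonal' fun i => (B i)⁻¹) ?_)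
  rw [← Matrix.blockDiagonal'_mul, ← Matrix.blockDiagonal'_one]
  congr 1
  ext1 i
  exact Matrix.mul_nonsing_inv _ (hB i).det_pos.ne'.isUnit

open scoped MatrixOrder Matrix.Norms.L2Operator in
/-- A positive definite quadratic form bounds the squares of the coordinates. -/
lemma Matrix.PosDef.exists_sq_le {ι : Type*} [Fintype ι] [DecidableEq ι] {S : Matrix ι ι ℝ}
    (hS : S.PosDef) : ∃ c : ℝ, 0 ≤ c ∧ ∀ (u : ι → ℝ) a, u a ^ 2 ≤ c * (u ⬝ᵥ (S *ᵥ u)) := by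
  -- Factor `S = Bᴴ B`. Then `u = B⁻¹ (B u)`, and Cauchy–Schwarz bounds each coordinate; the
  -- constant is the sum of the squared entries of `B⁻¹`, which serves all coordinates at once.
  obtain ⟨B, rfl⟩ := CStarAlgebra.nonneg_iff_eq_star_mul_self.mp hS.posSemidef.nonneg
  rw [Matrix.star_eq_conjTranspose] at hS ⊢
  have hB : IsUnit B.det := by
    have := (Matrix.isUnit_iff_isUnit_det _).1 hS.isUnit
    rw [Matrix.det_mul] at this
    exact isUnit_of_mul_isUnit_right this
  have hq : ∀ u : ι → ℝ, u ⬝ᵥ ((Bᴴ * B) *ᵥ u) = ∑ b, (B *ᵥ u) b ^ 2 := fun u => by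
    rw [← Matrix.mulVec_mulVec, Matrix.dotProduct_mulVec,
      Matrix.conjTranspose_eq_transpose_of_trivial, Matrix.vecMul_transpose]
    simp [dotProduct, sq]
  refine ⟨∑ a, ∑ b, B⁻¹ a b ^ 2, by positivity, fun u a => ?_⟩
  have hu : u a = ∑ b, B⁻¹ a b * (B *ᵥ u) b := by
    have : B⁻¹ *ᵥ (B *ᵥ u) = u := by
      rw [Matrix.mulVec_mulVec, Matrix.nonsing_inv_mul _ hB,
        Matrix.one_mulVec]
    conv_lhs => rw [← this]
    rfl
  rw [hq]
  calc u a ^ 2 ≤ (∑ b, B⁻¹ a b ^ 2) * ∑ b, (B *ᵥ u) b ^ 2 := by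
        rw [hu]; exact Finset.sum_mul_sq_le_sq_mul_sq _ _ _
    _ ≤ _ := by
        refine mul_le_mul_of_nonneg_right ?_ (by positivity)
        exact Finset.single_le_sum (f := fun a => ∑ b, B⁻¹ a b ^ 2)
          (fun _ _ => by positivity) (Finset.mem_univ a)

/-! ### Moments of the prescribed Gaussian laws -/

section MultivariateGaussian

variable {Ω ι : Type*} [Fintype ι] [DecidableEq ι] [MeasurableSpace Ω] {μ : Measure Ω}
  {Y : Ω → ι → ℝ} {S : Matrix ι ι ℝ}

lemma hasGaussianLaw_of_map_toLp
    (h : μ.map (fun ω => WithLp.toLp 2 (Y ω)) = multivariateGaussian 0 S) :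
    HasGaussianLaw Y μ := by
  have h1 : HasGaussianLaw (fun ω => WithLp.toLp 2 (Y ω)) μ := ⟨by rw [h]; infer_instance⟩
  exact h1.map_equiv (PiLp.continuousLinearEquiv 2 ℝ fun _ : ι => ℝ)

lemma integral_eq_zero_of_map_toLp (hY : Measurable Y)
    (h : μ.map (fun ω => WithLp.toLp 2 (Y ω)) = multivariateGaussian 0 S) (a : ι) :
    ∫ ω, Y ω a ∂μ = 0 := by
  have hm : Measurable (fun ω => WithLp.toLp 2 (Y ω)) := by fun_prop
  have h1 : ∫ ω, Y ω a ∂μ = ∫ z, z a ∂(multivariateGaussian 0 S) := by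
    rw [← h, integral_map hm.aemeasurable (by fun_prop)]
  rw [h1]
  have h2 := (EuclideanSpace.proj (𝕜 := ℝ) a).integral_comp_comm
    (IsGaussian.integrable_id (μ := multivariateGaussian (0 : EuclideanSpace ℝ ι) S))
  simpa using h2

lemma covMat_of_map_toLp (hY : Measurable Y) (hS : S.PosSemidef)
    (h : μ.map (fun ω => WithLp.toLp 2 (Y ω)) = multivariateGaussian 0 S) :
    covMat μ Y Y = S := by
  have hm : Measurable (fun ω => WithLp.toLp 2 (Y ω)) := by fun_prop
  ext a b
  rw [covMat_apply, ← covariance_eval_multivariateGaussian (μ := 0) hS a b, ← h,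
    covariance_map_fun (by fun_prop) (by fun_prop) hm.aemeasurable]

end MultivariateGaussian

/-! ### Propagation of information in the graph -/

namespace CommGraph

variable {n : ℕ} (G : CommGraph n)

lemma mem_info_iff {t : ℕ} {i : Fin n} {p : Fin n × ℕ} :
    p ∈ G.info t i ↔ (p.1 = i ∧ 1 ≤ p.2 ∧ p.2 ≤ t) ∨
      ∃ j, ((j, i) ∈ G.edges ∧ G.delay j i ≤ t) ∧ p ∈ G.info (t - G.delay j i) j := by
  rw [info]
  simp only [Finset.mem_union, Finset.mem_image, Finset.mem_Icc, Finset.mem_biUnion,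
    Finset.mem_univ, true_and]
  refine or_congr ?_ (exists_congr fun j => ?_)
  · constructor
    · rintro ⟨s, hs, rfl⟩
      exact ⟨rfl, hs⟩
    · rintro ⟨rfl, hs⟩
      exact ⟨p.2, hs, rfl⟩
  · split_ifs with h
    · simp [h]
    · simp [h]

lemma time_of_mem_info {t : ℕ} {i : Fin n} {p : Fin n × ℕ} (hp : p ∈ G.info t i) :
    1 ≤ p.2 ∧ p.2 ≤ t := by
  induction t using Nat.strong_induction_on generalizing i with
  | _ t ih =>
    rcases G.mem_info_iff.1 hp with h | ⟨j, ⟨h1, h2⟩, h3⟩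
    · exact h.2
    · have := G.delay_pos j i h1
      have := ih _ (by omega) h3
      omega

lemma info_subset_of_edge {t : ℕ} {i j : Fin n} (h : (j, i) ∈ G.edges) :
    G.info (t - G.delay j i) j ⊆ G.info t i := fun p hp => by
  by_cases ht : G.delay j i ≤ t
  · exact G.mem_info_iff.2 (Or.inr ⟨j, ⟨h, ht⟩, hp⟩)
  -- If the delay exceeds `t`, the truncated time is `0`, when no information is available.
  · have := G.time_of_mem_info hp
    omega

/-- Data travels edge by edge. The induction removes the first edge of the path, and its delay is
what is subtracted last from `t`. -/
lemma info_subset_of_isChain {i : Fin n} {t : ℕ} (l : List (Fin n)) (j : Fin n)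
    (hc : (j :: l).IsChain (fun a b => (a, b) ∈ G.edges)) (hl : (j :: l).getLast? = some i) :
    G.info (t - G.pathLength (j :: l)) j ⊆ G.info t i := by
  induction l generalizing j with
  | nil =>
    obtain rfl : j = i := by simpa using hl
    simp [pathLength]
  | cons b l ih =>
    rw [List.isChain_cons_cons] at hc
    rw [List.getLast?_cons_cons] at hl
    refine Finset.Subset.trans ?_ (ih b hc.2 hl)
    rw [pathLength, Nat.add_comm, ← Nat.sub_sub]
    exact G.info_subset_of_edge hc.1

lemma dist_le_diam (i j : Fin n) : G.dist i j ≤ G.diam :=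
  Finset.le_sup (f := fun p : Fin n × Fin n => G.dist p.1 p.2) (Finset.mem_univ (i, j))

variable {G}

lemma StronglyConnected.exists_dist_path (hG : G.StronglyConnected) (i j : Fin n) :
    ∃ l, G.IsPath i j l ∧ G.pathLength l = G.dist i j := by
  obtain ⟨l, hl⟩ := hG i j
  exact Nat.sInf_mem (s := {m | ∃ l, G.IsPath i j l ∧ G.pathLength l = m}) ⟨_, l, hl, rfl⟩

/-- Since `dist j i ≤ d*`, a measurement `y_j(s)` with `s ≤ t - d*` is already in `I_j(t - dist j
i)`, and a shortest path delivers it to `i` by time `t`. -/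
lemma StronglyConnected.common_subset_info (hG : G.StronglyConnected) (t : ℕ) (i : Fin n) :
    G.common t ⊆ G.info t i := by
  rintro ⟨j, s⟩ hp
  simp only [common, Finset.mem_product, Finset.mem_univ, true_and, Finset.mem_Icc] at hp
  obtain ⟨l, ⟨hc, -, hh, hl⟩, hlen⟩ := hG.exists_dist_path j i
  cases l with
  | nil => simp at hh
  | cons a l =>
    obtain rfl : a = j := by simpa using hh
    refine G.info_subset_of_isChain l a hc hl (G.mem_info_iff.2 (Or.inl ⟨rfl, hp.1, ?_⟩))
    have := G.dist_le_diam a i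
    rw [hlen]
    omega

/-- A path between two distinct nodes has at least one edge, and delays are positive. -/
lemma StronglyConnected.one_le_diam (hG : G.StronglyConnected) (hn : 2 ≤ n) : 1 ≤ G.diam := by
  have h01 : (⟨0, by omega⟩ : Fin n) ≠ ⟨1, by omega⟩ := by simp
  obtain ⟨l, ⟨hc, -, hh, hl⟩, hlen⟩ := hG.exists_dist_path ⟨0, by omega⟩ ⟨1, by omega⟩
  refine le_trans ?_ (G.dist_le_diam ⟨0, by omega⟩ ⟨1, by omega⟩)
  rw [← hlen]
  match l with
  | [] => simp at hh
  | [a] =>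
    have h0 : a = ⟨0, by omega⟩ := by simpa using hh
    have h1 : a = ⟨1, by omega⟩ := by simpa using hl
    exact absurd (h0.symm.trans h1) h01
  | a :: b :: l =>
    rw [List.isChain_cons_cons] at hc
    have := G.delay_pos a b hc.1
    rw [pathLength]
    omega

lemma one_le_delayedTime (t : ℕ) : 1 ≤ G.delayedTime t := le_max_left _ _

lemma delayedTime_le {t : ℕ} (ht : 1 ≤ t) : G.delayedTime t ≤ t :=
  max_le ht (Nat.sub_le _ _)

/-- The clipped times satisfy `t - d* = τ - 1`, which needs `1 ≤ d*`: for `d* = 0` the truncated `d*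
- 1` would shift the window by one step. -/
lemma StronglyConnected.common_eq (hG : G.StronglyConnected) (hn : 2 ≤ n) (t : ℕ) :
    G.common t = Finset.univ ×ˢ Finset.Icc 1 (G.delayedTime t - 1) := by
  have := hG.one_le_diam hn
  have h : t - G.diam = G.delayedTime t - 1 := by
    rw [delayedTime]
    omega
  rw [common, h]

/-- Local measurements are taken from `τ` on. So the exponents `s - τ` in `Cloc` are never
truncated, and these measurements are functions of `x(τ)` and later noises. -/
lemma StronglyConnected.delayedTime_le_of_mem_localInfo (hG : G.StronglyConnected) (hn : 2 ≤ n)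
    {t : ℕ} {i : Fin n} {p : Fin n × ℕ} (hp : p ∈ G.localInfo t i) :
    G.delayedTime t ≤ p.2 ∧ p.2 ≤ t := by
  rw [localInfo, Finset.mem_sdiff, hG.common_eq hn] at hp
  obtain ⟨h1, h2⟩ := G.time_of_mem_info hp.1
  refine ⟨?_, h2⟩
  by_contra h
  exact hp.2 (by simp; omega)

end CommGraph

/-! ### Linear spans of primitives and of measurements -/

/-- The time at which a primitive random variable enters the system. -/
def PrimitiveLabel.time {n : ℕ} : PrimitiveLabel n → ℕ
  | .init => 0
  | .process s => s + 1
  | .noise _ s => s + 1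

namespace Primitives

variable {n dx : ℕ} {dy dz : Fin n → ℕ} {M : TeamModel n dx dy dz} {Ω : Type*}
  (X : Primitives M Ω)

/-- A coordinate of a primitive random variable. -/
def coordVar (p : Σ k : PrimitiveLabel n, Fin (k.dim dx dy)) (ω : Ω) : ℝ := X.toFamily p.1 ω p.2

/-- The linear span of the coordinates of the primitive random variables with labels in `A`. -/
def primSpan (A : Set (PrimitiveLabel n)) : Submodule ℝ (Ω → ℝ) :=
  Submodule.span ℝ (X.coordVar '' {p | p.1 ∈ A})

/-- The linear span of the coordinates of the measurements with labels in `I`. -/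
def obsSpan (I : Finset (Fin n × ℕ)) : Submodule ℝ (Ω → ℝ) :=
  Submodule.span ℝ (Set.range fun (q : Σ p : I, Fin (dy p.1.1)) ω => X.y q.1.1.1 q.1.1.2 ω q.2)

/-- The random vector of the measurements with labels in `I`. -/
def obsVec (I : Finset (Fin n × ℕ)) (ω : Ω) : (p : I) → Fin (dy p.1.1) → ℝ :=
  fun p => X.y p.1.1 p.1.2 ω

/-- The stacked measurement noise. -/
def vAll (t : ℕ) (ω : Ω) : (Σ i, Fin (dy i)) → ℝ := fun p => X.v p.1 t ω p.2

/-- The error of the Kalman predictor. -/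
def err (t : ℕ) (ω : Ω) : Fin dx → ℝ := X.x t ω - X.xhat t ω

variable {X}

lemma primSpan_mono {A B : Set (PrimitiveLabel n)} (h : A ⊆ B) : X.primSpan A ≤ X.primSpan B :=
  Submodule.span_mono (Set.image_mono fun _ hp => h hp)

lemma vecMem_toFamily {A : Set (PrimitiveLabel n)} {k : PrimitiveLabel n} (hk : k ∈ A) :
    VecMem (X.primSpan A) (X.toFamily k) :=
  fun a => Submodule.subset_span ⟨⟨k, a⟩, hk, rfl⟩

lemma vecMem_w {A : Set (PrimitiveLabel n)} {t : ℕ} (ht : 1 ≤ t)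
    (hA : PrimitiveLabel.process (t - 1) ∈ A) : VecMem (X.primSpan A) (X.w t) := by
  have h := vecMem_toFamily (X := X) hA
  obtain ⟨s, rfl⟩ := Nat.exists_eq_add_of_le' ht
  exact h

lemma vecMem_v {A : Set (PrimitiveLabel n)} {t : ℕ} {i : Fin n} (ht : 1 ≤ t)
    (hA : PrimitiveLabel.noise i (t - 1) ∈ A) : VecMem (X.primSpan A) (X.v i t) := by
  have h := vecMem_toFamily (X := X) hA
  obtain ⟨s, rfl⟩ := Nat.exists_eq_add_of_le' ht
  exact h

variable (n) in
/-- The labels of the primitive random variables that enter before time `t`. -/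
def past (t : ℕ) : Set (PrimitiveLabel n) := {k | k.time < t}

lemma past_mono {s t : ℕ} (h : s ≤ t) : past n s ⊆ past n t :=
  fun _ hk => lt_of_lt_of_le (b := s) hk h

/-- The inequality in `past` is strict: `w(t)` and `v(t)` first act after `x(t)` is formed, so they
are left out and stay independent of it. -/
lemma vecMem_x (t : ℕ) : VecMem (X.primSpan (past n t)) (X.x t) := by
  induction t with
  | zero => exact VecMem.zero
  | succ t ih =>
    cases t with
    | zero => exact vecMem_toFamily (k := .init) (show 0 < 1 by omega)
    | succ t =>
      refine ((ih.mono (primSpan_mono (past_mono (Nat.le_succ _)))).mulVec M.A).add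
        (vecMem_w (Nat.le_add_left _ _) ?_)
      show t + 1 < t + 2
      omega

lemma vecMem_y (i : Fin n) {s t : ℕ} (hs : 1 ≤ s) (hst : s < t) :
    VecMem (X.primSpan (past n t)) (X.y i s) := by
  refine (((vecMem_x s).mono (primSpan_mono (past_mono hst.le))).mulVec (M.C i)).add
    (vecMem_v hs ?_)
  show s - 1 + 1 < t
  omega

lemma obsSpan_le {I : Finset (Fin n × ℕ)} {t : ℕ} (hI : ∀ p ∈ I, 1 ≤ p.2 ∧ p.2 < t) :
    X.obsSpan I ≤ X.primSpan (past n t) := by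
  refine Submodule.span_le.2 ?_
  rintro _ ⟨q, rfl⟩
  exact vecMem_y _ (hI _ q.1.2).1 (hI _ q.1.2).2 q.2

lemma vecMem_obs {I : Finset (Fin n × ℕ)} {i : Fin n} {s : ℕ} (h : (i, s) ∈ I) :
    VecMem (X.obsSpan I) (X.y i s) :=
  fun a => Submodule.subset_span ⟨⟨⟨(i, s), h⟩, a⟩, rfl⟩

lemma obsSpan_mono {I I' : Finset (Fin n × ℕ)} (h : I ⊆ I') : X.obsSpan I ≤ X.obsSpan I' := by
  refine Submodule.span_le.2 ?_
  rintro _ ⟨q, rfl⟩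
  exact vecMem_obs (h q.1.2) q.2

lemma vecMem_xhat (t : ℕ) :
    VecMem (X.obsSpan (Finset.univ ×ˢ Finset.Icc 1 (t - 1))) (X.xhat t) := by
  induction t with
  | zero => exact VecMem.zero
  | succ t ih =>
    cases t with
    | zero => exact VecMem.zero
    | succ t =>
      have ih' := ih.mono (obsSpan_mono (I' := Finset.univ ×ˢ Finset.Icc 1 (t + 2 - 1)) (by
        intro p; simp; omega))
      refine (ih'.mulVec M.A).add (VecMem.mulVec _ (VecMem.sub (fun p => ?_) (ih'.mulVec M.Cmat)))
      exact vecMem_obs (i := p.1) (s := t + 1) (by simp) p.2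

/-- Every linear combination of measurements is a linear functional of the vector of
measurements. -/
lemma exists_linearMap_of_mem_obsSpan {I : Finset (Fin n × ℕ)} {f : Ω → ℝ}
    (hf : f ∈ X.obsSpan I) :
    ∃ ℓ : ((p : I) → Fin (dy p.1.1) → ℝ) →ₗ[ℝ] ℝ, ∀ ω, f ω = ℓ (X.obsVec I ω) := by
  induction hf using Submodule.span_induction with
  | mem f hf =>
    obtain ⟨q, rfl⟩ := hf
    exact ⟨LinearMap.proj q.2 ∘ₗ LinearMap.proj q.1, fun _ => rfl⟩
  | zero => exact ⟨0, fun _ => rfl⟩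
  | add f g _ _ hf hg =>
    obtain ⟨ℓ, hℓ⟩ := hf
    obtain ⟨m, hm⟩ := hg
    exact ⟨ℓ + m, fun ω => by simp [hℓ, hm]⟩
  | smul c f _ hf =>
    obtain ⟨ℓ, hℓ⟩ := hf
    exact ⟨c • ℓ, fun ω => by simp [hℓ]⟩

/-! ### Gaussianity, independence and conditional expectation in the span -/

variable [MeasurableSpace Ω]

variable (X) in
/-- The assumptions on the laws of the primitive random variables. -/
structure IsGaussianModel (μ : Measure Ω) : Prop where
  measurable : ∀ k, Measurable (X.toFamily k)
  law_x1 : μ.map (fun ω => WithLp.toLp 2 (X.x1 ω)) = multivariateGaussian 0 M.Sx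
  law_w : ∀ t, 1 ≤ t → μ.map (fun ω => WithLp.toLp 2 (X.w t ω)) = multivariateGaussian 0 M.Q
  law_v : ∀ i t, 1 ≤ t →
    μ.map (fun ω => WithLp.toLp 2 (X.v i t ω)) = multivariateGaussian 0 (M.R i)
  posDef_R : ∀ i, (M.R i).PosDef
  posSemidef_Q : M.Q.PosSemidef
  posSemidef_Sx : M.Sx.PosSemidef
  indep : iIndepFun X.toFamily μ

namespace IsGaussianModel

variable {μ : Measure Ω} (H : X.IsGaussianModel μ)
include H

lemma isProbabilityMeasure : IsProbabilityMeasure μ := H.indep.isProbabilityMeasure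

lemma exists_law (k : PrimitiveLabel n) : ∃ S,
    μ.map (fun ω => WithLp.toLp 2 (X.toFamily k ω)) = multivariateGaussian 0 S := by
  cases k with
  | init => exact ⟨_, H.law_x1⟩
  | process t => exact ⟨_, H.law_w (t + 1) (by omega)⟩
  | noise i t => exact ⟨_, H.law_v i (t + 1) (by omega)⟩

/-- Independent Gaussian vectors are jointly Gaussian. A finite set of coordinates involves finitely
many labels `J`, and is a linear image of the joint vector of these. -/
lemma isGaussianProcess_coordVar : IsGaussianProcess X.coordVar μ where
  hasGaussianLaw I := by
    classical
    let J := I.image Sigma.fst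
    have h := (H.indep.precomp (g := ((↑) : J → PrimitiveLabel n))
      Subtype.val_injective).hasGaussianLaw
      fun k => hasGaussianLaw_of_map_toLp (H.exists_law k.1).choose_spec
    let L : ((k : J) → Fin (k.1.dim dx dy) → ℝ) →L[ℝ] (I → ℝ) :=
      LinearMap.toContinuousLinearMap (LinearMap.pi fun p : I => LinearMap.proj p.1.2 ∘ₗ
        LinearMap.proj (⟨p.1.1, Finset.mem_image_of_mem _ p.2⟩ : J))
    exact h.map_fun L

/-- The span of the primitive random variables is a Gaussian process. -/
lemma isGaussianProcess_primSpan (A : Set (PrimitiveLabel n)) :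
    IsGaussianProcess (fun f : X.primSpan A => f.1) μ := by
  refine IsGaussianProcess.of_isGaussianProcess H.isGaussianProcess_coordVar fun f => ?_
  have hf : f.1 ∈ Submodule.span ℝ (Set.range X.coordVar) :=
    Submodule.span_mono (Set.image_subset_range _ _) f.2
  obtain ⟨c, hc⟩ := Finsupp.mem_span_range_iff_exists_finsupp.1 hf
  refine ⟨c.support, ∑ p : c.support, c p.1 • ContinuousLinearMap.proj p, fun ω => ?_⟩
  rw [← hc, Finsupp.sum, Finset.sum_apply, ← Finset.sum_coe_sort]
  simp

lemma memLp {A : Set (PrimitiveLabel n)} {f : Ω → ℝ} (hf : f ∈ X.primSpan A) : MemLp f 2 μ :=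
  ((H.isGaussianProcess_primSpan A).hasGaussianLaw_eval ⟨f, hf⟩).memLp_two

lemma sqIntegrable {ι : Type*} {A : Set (PrimitiveLabel n)} {Y : Ω → ι → ℝ}
    (hY : VecMem (X.primSpan A) Y) : SqIntegrable μ Y := fun a => H.memLp (hY a)

lemma measurable_of_mem {A : Set (PrimitiveLabel n)} {f : Ω → ℝ} (hf : f ∈ X.primSpan A) :
    Measurable f := by
  induction hf using Submodule.span_induction with
  | mem f hf =>
    obtain ⟨q, -, rfl⟩ := hf
    exact (measurable_pi_apply q.2).comp (H.measurable q.1)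
  | zero => exact measurable_const
  | add f g _ _ hf hg => exact hf.add hg
  | smul c f _ hf => exact hf.const_smul c

lemma measurable_vec {ι : Type*} {A : Set (PrimitiveLabel n)} {Y : Ω → ι → ℝ}
    (hY : VecMem (X.primSpan A) Y) : Measurable Y :=
  measurable_pi_lambda _ fun a => H.measurable_of_mem (hY a)

lemma integral_eq_zero {A : Set (PrimitiveLabel n)} {f : Ω → ℝ} (hf : f ∈ X.primSpan A) :
    ∫ ω, f ω ∂μ = 0 := by
  have := H.isProbabilityMeasure
  induction hf using Submodule.span_induction with
  | mem f hf =>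
    obtain ⟨q, -, rfl⟩ := hf
    exact integral_eq_zero_of_map_toLp (H.measurable q.1) (H.exists_law q.1).choose_spec q.2
  | zero => simp
  | add f g hf' hg' hf hg =>
    simp only [Pi.add_apply]
    rw [integral_add ((H.memLp hf').integrable one_le_two)
      ((H.memLp hg').integrable one_le_two), hf, hg, add_zero]
  | smul c f _ hf =>
    simp only [Pi.smul_apply, smul_eq_mul]
    rw [integral_const_mul, hf, mul_zero]

/-- All means vanish, so the covariance is the `L²` inner product; this turns expected costs into
covariance matrices. -/
lemma integral_mul_eq_covariance {A B : Set (PrimitiveLabel n)} {f g : Ω → ℝ}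
    (hf : f ∈ X.primSpan A) (hg : g ∈ X.primSpan B) : ∫ ω, f ω * g ω ∂μ = cov[f, g; μ] := by
  have := H.isProbabilityMeasure
  rw [covariance_eq_sub (H.memLp hf) (H.memLp hg), H.integral_eq_zero hf, zero_mul, sub_zero]
  rfl

/-- If a square-integrable variable is uncorrelated with generators, then with their span. -/
lemma covariance_eq_zero_of_span {f : Ω → ℝ} (hf : MemLp f 2 μ) {s : Set (Ω → ℝ)}
    (hs : ∀ g ∈ s, MemLp g 2 μ ∧ cov[f, g; μ] = 0) {g : Ω → ℝ} (hg : g ∈ Submodule.span ℝ s) :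
    MemLp g 2 μ ∧ cov[f, g; μ] = 0 := by
  have := H.isProbabilityMeasure
  induction hg using Submodule.span_induction with
  | mem g hg => exact hs g hg
  | zero => exact ⟨MemLp.zero, covariance_zero_right⟩
  | add g h _ _ hg hh =>
    exact ⟨hg.1.add hh.1, by rw [covariance_add_right hf hg.1 hh.1, hg.2, hh.2, add_zero]⟩
  | smul c g _ hg =>
    exact ⟨hg.1.const_smul c, by rw [covariance_smul_right, hg.2, mul_zero]⟩

lemma covariance_eq_zero_of_disjoint {A B : Set (PrimitiveLabel n)} (hAB : Disjoint A B)
    {f g : Ω → ℝ} (hf : f ∈ X.primSpan A) (hg : g ∈ X.primSpan B) : cov[f, g; μ] = 0 := by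
  refine (H.covariance_eq_zero_of_span (H.memLp hf) ?_ hg).2
  rintro _ ⟨q, hq, rfl⟩
  have hqm : X.coordVar q ∈ X.primSpan B := Submodule.subset_span ⟨q, hq, rfl⟩
  refine ⟨H.memLp hqm, ?_⟩
  rw [covariance_comm]
  refine (H.covariance_eq_zero_of_span (H.memLp hqm) ?_ hf).2
  rintro _ ⟨p, hp, rfl⟩
  have hpm : X.coordVar p ∈ X.primSpan A := Submodule.subset_span ⟨p, hp, rfl⟩
  have hpq : q.1 ≠ p.1 := fun h => Set.disjoint_left.1 hAB hp (h ▸ hq)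
  exact ⟨H.memLp hpm, ((H.indep.indepFun hpq).comp (measurable_pi_apply q.2)
    (measurable_pi_apply p.2)).covariance_eq_zero (H.memLp hqm) (H.memLp hpm)⟩

lemma covMat_eq_zero_of_disjoint {ι κ : Type*} {A B : Set (PrimitiveLabel n)}
    (hAB : Disjoint A B) {Y : Ω → ι → ℝ} {Z : Ω → κ → ℝ} (hY : VecMem (X.primSpan A) Y)
    (hZ : VecMem (X.primSpan B) Z) : covMat μ Y Z = 0 := by
  ext a b
  exact H.covariance_eq_zero_of_disjoint hAB (hY a) (hZ b)

lemma covMat_eq_zero_of_obsSpan {ι κ : Type*} {A : Set (PrimitiveLabel n)}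
    {I : Finset (Fin n × ℕ)} {Y : Ω → ι → ℝ} {Z : Ω → κ → ℝ}
    (hI : ∀ p ∈ I, 1 ≤ p.2)
    (hY : VecMem (X.primSpan A) Y) (hYI : ∀ p ∈ I, covMat μ Y (X.y p.1 p.2) = 0)
    (hZ : VecMem (X.obsSpan I) Z) : covMat μ Y Z = 0 := by
  ext a b
  refine (H.covariance_eq_zero_of_span (H.memLp (hY a)) ?_ (hZ b)).2
  rintro _ ⟨q, rfl⟩
  exact ⟨H.memLp (vecMem_y _ (hI _ q.1.2) (Nat.lt_succ_self _) q.2),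
    congr_fun (congr_fun (hYI q.1.1 q.1.2) a) q.2⟩

lemma measurable_obsVec {I : Finset (Fin n × ℕ)} (hI : ∀ p ∈ I, 1 ≤ p.2) :
    Measurable (X.obsVec I) :=
  measurable_pi_lambda _ fun p =>
    H.measurable_vec (vecMem_y p.1.1 (hI _ p.2) (Nat.lt_succ_self _))

/-- Uncorrelated vectors of the Gaussian span are independent. -/
lemma indepFun_obsVec {ι : Type*} {A : Set (PrimitiveLabel n)} {I : Finset (Fin n × ℕ)}
    (hI : ∀ p ∈ I, 1 ≤ p.2) {Y : Ω → ι → ℝ} (hY : VecMem (X.primSpan A) Y)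
    (hYI : ∀ p ∈ I, covMat μ Y (X.y p.1 p.2) = 0) : IndepFun Y (X.obsVec I) μ := by
  let Z : (Σ p : I, Fin (dy p.1.1)) → Ω → ℝ := fun q ω => X.y q.1.1.1 q.1.1.2 ω q.2
  have hYm : ∀ a, (fun ω => Y ω a) ∈ X.primSpan Set.univ :=
    hY.mono (primSpan_mono (Set.subset_univ _))
  have hZm : ∀ q, Z q ∈ X.primSpan Set.univ := fun q =>
    primSpan_mono (Set.subset_univ _) (vecMem_y _ (hI _ q.1.2) (Nat.lt_succ_self _) q.2)
  -- Joint Gaussianity of `Y` and the measurements is what upgrades zero correlation to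
  -- independence; it holds because both lie in one Gaussian span.
  have hG : IsGaussianProcess (Sum.elim (fun a ω => Y ω a) Z) μ := by
    convert! (H.isGaussianProcess_primSpan Set.univ).comp_right
      (Sum.elim (fun a => ⟨fun ω => Y ω a, hYm a⟩) fun q => ⟨Z q, hZm q⟩) using 1
    ext (_ | _) <;> rfl
  have h := hG.indepFun_of_covariance_eq_zero
    (fun a => (H.measurable_of_mem (hYm a)).aemeasurable)
    (fun q => (H.measurable_of_mem (hZm q)).aemeasurable)
    fun a q => congr_fun (congr_fun (hYI q.1.1 q.1.2) a) q.2
  exact h.comp (ψ := fun z p a => z ⟨p, a⟩) measurable_id (by fun_prop)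

/-- A linear function of measurements whose error is uncorrelated with them is the conditional
expectation. -/
lemma ae_eq_condExp {ι : Type*} [Fintype ι] {A B : Set (PrimitiveLabel n)}
    {I : Finset (Fin n × ℕ)} (hI : ∀ p ∈ I, 1 ≤ p.2) {Y Yhat : Ω → ι → ℝ}
    (hY : VecMem (X.primSpan A) (fun ω => Y ω - Yhat ω)) (hYhat : VecMem (X.obsSpan I) Yhat)
    (hYhat' : VecMem (X.primSpan B) Yhat)
    (hYI : ∀ p ∈ I, covMat μ (fun ω => Y ω - Yhat ω) (X.y p.1 p.2) = 0) :
    Yhat =ᵐ[μ] μ[Y | MeasurableSpace.comap (X.obsVec I) inferInstance] := by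
  have := H.isProbabilityMeasure
  have hm := (H.measurable_obsVec hI).comap_le
  have hint : ∀ {C : Set (PrimitiveLabel n)} {Z : Ω → ι → ℝ}, VecMem (X.primSpan C) Z →
      Integrable Z μ := fun hZ =>
    Integrable.of_eval fun a => (H.memLp (hZ a)).integrable one_le_two
  -- By independence the conditional expectation of the error is its mean, which is zero; `Yhat`
  -- itself is measurable with respect to the conditioning.
  have h1 : μ[fun ω => Y ω - Yhat ω | MeasurableSpace.comap (X.obsVec I) inferInstance]
      =ᵐ[μ] fun _ => 0 := by
    refine (condExp_indep_eq (H.measurable_vec hY).comap_le hm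
      (comap_measurable _).stronglyMeasurable (H.indepFun_obsVec hI hY hYI)).trans ?_
    refine Filter.Eventually.of_forall fun _ => ?_
    ext a
    simp only
    rw [eval_integral fun a => (H.memLp (hY a)).integrable one_le_two]
    exact H.integral_eq_zero (hY a)
  have h2 : StronglyMeasurable[MeasurableSpace.comap (X.obsVec I) inferInstance] Yhat := by
    refine Measurable.stronglyMeasurable ?_
    refine @measurable_pi_lambda _ _ _ (_) _ _ fun a => ?_
    obtain ⟨ℓ, hℓ⟩ := exists_linearMap_of_mem_obsSpan (hYhat a)
    have : (fun ω => Yhat ω a) = ℓ ∘ X.obsVec I := funext hℓ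
    rw [this]
    exact (LinearMap.continuous_of_finiteDimensional ℓ).measurable.comp (comap_measurable _)
  have h3 : Y = (fun ω => Y ω - Yhat ω) + Yhat := by
    ext ω a
    simp
  rw [h3]
  refine Filter.EventuallyEq.symm ((condExp_add (hint hY) (hint hYhat') _).trans ?_)
  rw [condExp_of_stronglyMeasurable hm h2 (hint hYhat')]
  filter_upwards [h1] with ω hω
  simp [hω]

end IsGaussianModel

end Primitives

/-! ### Kalman predictor, its error and the delayed decomposition -/

namespace Primitives

variable {n dx : ℕ} {dy dz : Fin n → ℕ} {M : TeamModel n dx dy dz} {Ω : Type*}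
  {X : Primitives M Ω}

variable (n) in
/-- The labels of the process noises from time `t` on. -/
def processFrom (t : ℕ) : Set (PrimitiveLabel n) := {k | ∃ s, k = .process s ∧ t ≤ s + 1}

variable (n) in
/-- The labels of the measurement noises from time `t` on. -/
def noiseFrom (t : ℕ) : Set (PrimitiveLabel n) := {k | ∃ i s, k = .noise i s ∧ t ≤ s + 1}

lemma disjoint_past_processFrom (t : ℕ) : Disjoint (past n t) (processFrom n t) := by
  rw [Set.disjoint_left]
  rintro k hk ⟨s, rfl, hs⟩
  exact absurd (show s + 1 < t from hk) (by omega)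

lemma disjoint_past_noiseFrom (t : ℕ) : Disjoint (past n t) (noiseFrom n t) := by
  rw [Set.disjoint_left]
  rintro k hk ⟨i, s, rfl, hs⟩
  exact absurd (show s + 1 < t from hk) (by omega)

lemma disjoint_processFrom_noiseFrom (s t : ℕ) : Disjoint (processFrom n s) (noiseFrom n t) := by
  rw [Set.disjoint_left]
  rintro k ⟨_, rfl, _⟩ ⟨_, _, h, _⟩
  cases h

lemma vecMem_w_processFrom {s t : ℕ} (ht : 1 ≤ t) (h : s ≤ t) :
    VecMem (X.primSpan (processFrom n s)) (X.w t) :=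
  vecMem_w ht ⟨t - 1, rfl, by omega⟩

lemma vecMem_v_noiseFrom {s t : ℕ} (i : Fin n) (ht : 1 ≤ t) (h : s ≤ t) :
    VecMem (X.primSpan (noiseFrom n s)) (X.v i t) :=
  vecMem_v ht ⟨i, t - 1, rfl, by omega⟩

lemma vecMem_vAll {t : ℕ} (ht : 1 ≤ t) : VecMem (X.primSpan (noiseFrom n t)) (X.vAll t) :=
  fun p => vecMem_v_noiseFrom p.1 ht le_rfl p.2

lemma yAll_eq (t : ℕ) (ω : Ω) : X.yAll t ω = M.Cmat *ᵥ X.x t ω + X.vAll t ω := by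
  ext p
  rfl

lemma vecMem_xhat_past (t : ℕ) : VecMem (X.primSpan (past n t)) (X.xhat t) :=
  (vecMem_xhat t).mono (obsSpan_le fun p hp => by simp at hp; omega)

lemma vecMem_err (t : ℕ) : VecMem (X.primSpan (past n t)) (X.err t) :=
  (vecMem_x t).sub (vecMem_xhat_past t)

/-- Since `y = C x + v`, the innovation is `C` times the error plus `v`. The error thus obeys its
own recursion, driven by fresh noise. -/
lemma err_succ (t : ℕ) : X.err (t + 2) = fun ω =>
    (M.A * (1 - M.K (t + 1) * M.Cmat)) *ᵥ X.err (t + 1) ω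
      - (M.A * M.K (t + 1)) *ᵥ X.vAll (t + 1) ω + X.w (t + 1) ω := by
  funext ω
  simp only [err, x, xhat, yAll_eq, Matrix.mul_sub, Matrix.sub_mulVec, Matrix.mulVec_sub,
    Matrix.mulVec_add, Matrix.mul_one, Matrix.mulVec_mulVec, Matrix.mul_assoc]
  abel

/-- The accumulated process noise between the times `s` and `t`. -/
def procSum (X : Primitives M Ω) (s t : ℕ) (ω : Ω) : Fin dx → ℝ :=
  ∑ r ∈ Finset.Icc s (t - 1), M.A ^ (t - r - 1) *ᵥ X.w r ω

lemma x_eq_of_le {s t : ℕ} (hs : 1 ≤ s) (hst : s ≤ t) (ω : Ω) :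
    X.x t ω = M.A ^ (t - s) *ᵥ X.x s ω + X.procSum s t ω := by
  induction t, hst using Nat.le_induction with
  | base =>
    have : Finset.Icc s (s - 1) = ∅ := Finset.Icc_eq_empty (by omega)
    simp [procSum, this]
  | succ t hst ih =>
    obtain ⟨u, rfl⟩ := Nat.exists_eq_add_of_le' (hs.trans hst)
    have h1 : X.procSum s (u + 1 + 1) ω = M.A *ᵥ X.procSum s (u + 1) ω + X.w (u + 1) ω := by
      rw [procSum, procSum, Nat.add_sub_cancel, Finset.sum_Icc_succ_top hst, Nat.add_sub_cancel]
      congr 1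
      · rw [Matrix.mulVec_sum]
        refine Finset.sum_congr rfl fun r hr => ?_
        rw [Finset.mem_Icc] at hr
        rw [Matrix.mulVec_mulVec, ← pow_succ']
        congr 2
        omega
      · simp
    have h2 : u + 1 + 1 - s = (u + 1 - s) + 1 := by omega
    rw [h1, h2, pow_succ', ← Matrix.mulVec_mulVec, ← add_assoc, ← Matrix.mulVec_add, ← ih]
    rfl

lemma vecMem_procSum {s t : ℕ} (hs : 1 ≤ s) :
    VecMem (X.primSpan (processFrom n s)) (X.procSum s t) :=
  VecMem.sum fun r hr => by
    rw [Finset.mem_Icc] at hr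
    exact (vecMem_w_processFrom (hs.trans hr.1) hr.1).mulVec _

/-- Reconciles two indexings: `wsum` counts lags backwards from `t`, and its clipped lower limit is
exactly `τ`. -/
lemma wsum_eq_procSum {t s : ℕ} (hs : s ≤ t) :
    X.wsum (M.G.diam - 1) (t - s) t = X.procSum (M.G.delayedTime t) s := by
  funext ω
  have h : t - (t - s) - 1 = s - 1 := by omega
  rw [wsum, procSum, h, CommGraph.delayedTime]
  refine Finset.sum_congr rfl fun r _ => ?_
  congr 2
  omega

lemma wsum_zero_eq_procSum (t : ℕ) :
    X.wsum (M.G.diam - 1) 0 t = X.procSum (M.G.delayedTime t) t := by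
  simpa using wsum_eq_procSum (X := X) (le_refl t)

section Graph

variable (hG : M.G.StronglyConnected) (hn : 2 ≤ n)
include hG hn

lemma locTilde_eq (t : ℕ) (i : Fin n) (ω : Ω) :
    X.locTilde t i ω = M.Cloc t i *ᵥ X.xtilde t ω + X.wloc t i ω + X.vloc t i ω := by
  ext q
  obtain ⟨h1, h2⟩ := hG.delayedTime_le_of_mem_localInfo hn q.1.2
  have h3 : ∀ z, (M.Cloc t i *ᵥ z) q =
      (M.C q.1.1.1 *ᵥ (M.A ^ (q.1.1.2 - M.G.delayedTime t) *ᵥ z)) q.2 := fun z => by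
    rw [Matrix.mulVec_mulVec]
    rfl
  simp only [locTilde, locVec, locHat, y, wloc, vloc, Pi.sub_apply, Pi.add_apply, h3,
    x_eq_of_le (CommGraph.one_le_delayedTime t) h1, wsum_eq_procSum h2, xtilde,
    Matrix.mulVec_sub, Matrix.mulVec_add]
  ring

lemma vecMem_wloc (t : ℕ) (i : Fin n) :
    VecMem (X.primSpan (processFrom n (M.G.delayedTime t))) (X.wloc t i) := fun q => by
  obtain ⟨h1, h2⟩ := hG.delayedTime_le_of_mem_localInfo hn q.1.2
  have h := (vecMem_procSum (X := X) (t := q.1.1.2)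
    (CommGraph.one_le_delayedTime (G := M.G) t)).mulVec (M.C q.1.1.1) q.2
  simpa only [wloc, wsum_eq_procSum h2] using h

lemma vecMem_vloc (t : ℕ) (i : Fin n) :
    VecMem (X.primSpan (noiseFrom n (M.G.delayedTime t))) (X.vloc t i) := fun q => by
  obtain ⟨h1, h2⟩ := hG.delayedTime_le_of_mem_localInfo hn q.1.2
  exact vecMem_v_noiseFrom q.1.1.1 ((CommGraph.one_le_delayedTime t).trans h1) h1 q.2

/-- Agent `i` can compute its innovation: the predictor at `τ` uses common measurements only, and
these are all available to `i`. -/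
lemma vecMem_locTilde_obsSpan (t : ℕ) (i : Fin n) :
    VecMem (X.obsSpan (M.G.info t i)) (X.locTilde t i) := by
  refine VecMem.sub (fun q => ?_) (VecMem.mulVec _ ((vecMem_xhat _).mono (obsSpan_mono ?_)))
  · exact vecMem_obs (Finset.mem_sdiff.1 q.1.2).1 q.2
  · rw [← hG.common_eq hn]
    exact hG.common_subset_info t i

lemma vecMem_xhat_common (t : ℕ) :
    VecMem (X.obsSpan (M.G.common t)) (X.xhat (M.G.delayedTime t)) := by
  rw [hG.common_eq hn]
  exact vecMem_xhat _

lemma mem_common_time {t : ℕ} {p : Fin n × ℕ} (hp : p ∈ M.G.common t) :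
    1 ≤ p.2 ∧ p.2 < M.G.delayedTime t := by
  rw [hG.common_eq hn] at hp
  simp at hp
  omega

lemma obsSpan_common_le (t : ℕ) :
    X.obsSpan (M.G.common t) ≤ X.primSpan (past n (M.G.delayedTime t)) :=
  obsSpan_le fun _ hp => mem_common_time hG hn hp

lemma vecMem_xcom (t : ℕ) : VecMem (X.obsSpan (M.G.common t)) (X.xcom t) :=
  (vecMem_xhat_common hG hn t).mulVec _

lemma vecMem_locHat (t : ℕ) (i : Fin n) : VecMem (X.obsSpan (M.G.common t)) (X.locHat t i) :=
  (vecMem_xhat_common hG hn t).mulVec _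

lemma vecMem_locTilde (t : ℕ) (i : Fin n) :
    VecMem (X.primSpan Set.univ) (X.locTilde t i) := by
  have h := (((vecMem_err (X := X) (M.G.delayedTime t)).mono
    (primSpan_mono (Set.subset_univ _))).mulVec (M.Cloc t i)).add
    ((vecMem_wloc hG hn t i).mono (primSpan_mono (Set.subset_univ _))) |>.add
    ((vecMem_vloc hG hn t i).mono (primSpan_mono (Set.subset_univ _)))
  rwa [funext (locTilde_eq hG hn t i)]

end Graph

/-- The error `x(t) - x̂^com(t)` of the common estimate. -/
def comErr (X : Primitives M Ω) (t : ℕ) (ω : Ω) : Fin dx → ℝ := X.x t ω - X.xcom t ω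

lemma comErr_eq {t : ℕ} (ht : 1 ≤ t) (ω : Ω) : X.comErr t ω =
    M.A ^ (t - M.G.delayedTime t) *ᵥ X.xtilde t ω + X.wsum (M.G.diam - 1) 0 t ω := by
  rw [comErr, wsum_zero_eq_procSum, x_eq_of_le (CommGraph.one_le_delayedTime (G := M.G) t)
    (CommGraph.delayedTime_le ht), xcom, xtilde, Matrix.mulVec_sub]
  abel

lemma vecMem_wsum (t : ℕ) : VecMem (X.primSpan (processFrom n (M.G.delayedTime t)))
    (X.wsum (M.G.diam - 1) 0 t) := by
  rw [wsum_zero_eq_procSum]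
  exact vecMem_procSum (CommGraph.one_le_delayedTime t)

lemma vecMem_xtilde (t : ℕ) :
    VecMem (X.primSpan (past n (M.G.delayedTime t))) (X.xtilde t) := vecMem_err _

lemma vecMem_comErr {t : ℕ} (ht : 1 ≤ t) :
    VecMem (X.primSpan Set.univ) (X.comErr t) := by
  rw [funext (comErr_eq ht)]
  exact (((vecMem_xtilde t).mono (primSpan_mono (Set.subset_univ _))).mulVec _).add
    ((vecMem_wsum t).mono (primSpan_mono (Set.subset_univ _)))

variable [MeasurableSpace Ω] {μ : Measure Ω}

namespace IsGaussianModel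

variable (H : X.IsGaussianModel μ)
include H

lemma covMat_v {i j : Fin n} {s t : ℕ} (hs : 1 ≤ s) (ht : 1 ≤ t) (h : (i, s) ≠ (j, t)) :
    covMat μ (X.v i s) (X.v j t) = 0 := by
  refine H.covMat_eq_zero_of_disjoint (A := {.noise i (s - 1)}) (B := {.noise j (t - 1)}) ?_
    (vecMem_v hs rfl) (vecMem_v ht rfl)
  rw [Set.disjoint_singleton]
  rintro h'
  injection h' with h1 h2
  exact h (by rw [h1, show s = t by omega])

lemma covMat_v_self (i : Fin n) {t : ℕ} (ht : 1 ≤ t) : covMat μ (X.v i t) (X.v i t) = M.R i :=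
  covMat_of_map_toLp (H.measurable_vec (vecMem_v_noiseFrom i ht le_rfl)) (H.posDef_R i).posSemidef
    (H.law_v i t ht)

lemma covMat_w_self {t : ℕ} (ht : 1 ≤ t) : covMat μ (X.w t) (X.w t) = M.Q :=
  covMat_of_map_toLp (H.measurable_vec (vecMem_w_processFrom ht le_rfl)) H.posSemidef_Q
    (H.law_w t ht)

lemma covMat_vAll {t : ℕ} (ht : 1 ≤ t) : covMat μ (X.vAll t) (X.vAll t) = M.Rmat := by
  ext ⟨i, a⟩ ⟨j, b⟩
  by_cases hij : i = j
  · subst hij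
    rw [TeamModel.Rmat, Matrix.blockDiagonal'_apply_eq, ← H.covMat_v_self i ht]
    rfl
  · rw [TeamModel.Rmat, Matrix.blockDiagonal'_apply_ne _ _ _ hij]
    exact congr_fun (congr_fun (H.covMat_v (i := i) (j := j) ht ht (by simp [hij])) a) b

/-- Semidefiniteness is free, the matrix being the covariance of the stacked noise at time `1`;
definiteness then comes from the blocks. -/
lemma posDef_Rmat : M.Rmat.PosDef := by
  have := H.isProbabilityMeasure
  refine Matrix.PosSemidef.posDef_blockDiagonal' ?_ H.posDef_R
  change M.Rmat.PosSemidef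
  rw [← H.covMat_vAll le_rfl]
  exact covMat_posSemidef (H.sqIntegrable (vecMem_vAll le_rfl))

lemma covMat_err_vAll {t : ℕ} (ht : 1 ≤ t) : covMat μ (X.err t) (X.vAll t) = 0 :=
  H.covMat_eq_zero_of_disjoint (disjoint_past_noiseFrom t) (vecMem_err t) (vecMem_vAll ht)

lemma covMat_err_w {t : ℕ} (ht : 1 ≤ t) : covMat μ (X.err t) (X.w t) = 0 :=
  H.covMat_eq_zero_of_disjoint (disjoint_past_processFrom t) (vecMem_err t)
    (vecMem_w_processFrom ht le_rfl)

lemma covMat_w_vAll {t : ℕ} (ht : 1 ≤ t) : covMat μ (X.w t) (X.vAll t) = 0 :=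
  H.covMat_eq_zero_of_disjoint (disjoint_processFrom_noiseFrom t t)
    (vecMem_w_processFrom ht le_rfl) (vecMem_vAll ht)

/-- The Riccati recursion gives the covariance of the prediction error. -/
lemma covMat_err {t : ℕ} (ht : 1 ≤ t) : covMat μ (X.err t) (X.err t) = M.P t := by
  have := H.isProbabilityMeasure
  induction t, ht using Nat.le_induction with
  | base =>
    have h : X.err 1 = X.x1 := by
      funext ω
      simp [err, x, xhat]
    rw [h]
    exact covMat_of_map_toLp (H.measurable .init) H.posSemidef_Sx H.law_x1
  | succ t ht ih =>
    obtain ⟨u, rfl⟩ := Nat.exists_eq_add_of_le' ht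
    have he := H.sqIntegrable (vecMem_err (X := X) (u + 1))
    have hv := H.sqIntegrable (vecMem_vAll (X := X) ht)
    have hw := H.sqIntegrable (vecMem_w_processFrom (X := X) ht le_rfl)
    -- The error and the two fresh noises are pairwise uncorrelated, so only three terms of the
    -- bilinear expansion survive. No optimality of the gain is needed.
    have hve : covMat μ (X.vAll (u + 1)) (X.err (u + 1)) = 0 := by
      rw [← covMat_transpose, H.covMat_err_vAll ht, Matrix.transpose_zero]
    have hwe : covMat μ (X.w (u + 1)) (X.err (u + 1)) = 0 := by
      rw [← covMat_transpose, H.covMat_err_w ht, Matrix.transpose_zero]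
    have hvw : covMat μ (X.vAll (u + 1)) (X.w (u + 1)) = 0 := by
      rw [← covMat_transpose, H.covMat_w_vAll ht, Matrix.transpose_zero]
    set B := M.A * (1 - M.K (u + 1) * M.Cmat) with hB
    set D := M.A * M.K (u + 1) with hD
    have hs := (he.mulVec B).sub (hv.mulVec D)
    rw [err_succ, covMat_add_left hs hw (hs.add hw), covMat_add_right hs hw hs,
      covMat_add_right hs hw hw, covMat_sub_left (he.mulVec B) (hv.mulVec D) hs,
      covMat_sub_right (he.mulVec B) (hv.mulVec D) (he.mulVec B),
      covMat_sub_right (he.mulVec B) (hv.mulVec D) (hv.mulVec D),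
      covMat_sub_left (he.mulVec B) (hv.mulVec D) hw,
      covMat_sub_right (he.mulVec B) (hv.mulVec D) hw]
    simp only [covMat_mulVec_left _ he (he.mulVec B), covMat_mulVec_left _ he (hv.mulVec D),
      covMat_mulVec_left _ hv (he.mulVec B), covMat_mulVec_left _ hv (hv.mulVec D),
      covMat_mulVec_left _ he hw, covMat_mulVec_left _ hv hw,
      covMat_mulVec_right _ he he, covMat_mulVec_right _ hv he, covMat_mulVec_right _ he hv,
      covMat_mulVec_right _ hv hv, covMat_mulVec_right _ he hw, covMat_mulVec_right _ hv hw,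
      ih, hve, hwe, hvw, H.covMat_err_vAll ht, H.covMat_err_w ht, H.covMat_w_vAll ht,
      H.covMat_vAll ht, H.covMat_w_self ht]
    have hP : M.P (u + 1 + 1) = B * M.P (u + 1) * Bᵀ + D * M.Rmat * Dᵀ + M.Q := by
      rw [hB, hD, TeamModel.P]
      simp only [Matrix.transpose_mul, Matrix.mul_assoc, TeamModel.K]
    rw [hP]
    simp [Matrix.mul_assoc]

lemma posSemidef_P {t : ℕ} (ht : 1 ≤ t) : (M.P t).PosSemidef := by
  have := H.isProbabilityMeasure
  rw [← H.covMat_err ht]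
  exact covMat_posSemidef (H.sqIntegrable (vecMem_err t))

/-- Definiteness of `R` makes the innovation covariance invertible. This normal equation is the only
property of the gain behind the orthogonality of the errors. -/
lemma K_mul {t : ℕ} (ht : 1 ≤ t) :
    M.K t * (M.Cmat * M.P t * M.Cmatᵀ + M.Rmat) = M.P t * M.Cmatᵀ := by
  have h : (M.Cmat * M.P t * M.Cmatᵀ + M.Rmat).PosDef := by
    refine Matrix.PosDef.posSemidef_add ?_ H.posDef_Rmat
    have := (H.posSemidef_P ht).mul_mul_conjTranspose_same M.Cmat
    rwa [Matrix.conjTranspose_eq_transpose_of_trivial] at this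
  rw [TeamModel.K, TeamModel.gainOf, Matrix.mul_assoc,
    Matrix.nonsing_inv_mul _ h.det_pos.ne'.isUnit, Matrix.mul_one]

/-- The prediction error is uncorrelated with the past measurements. -/
lemma covMat_err_yAll {t : ℕ} (ht : 1 ≤ t) {s : ℕ} (hs : 1 ≤ s) (hst : s < t) :
    covMat μ (X.err t) (X.yAll s) = 0 := by
  have := H.isProbabilityMeasure
  induction t, ht using Nat.le_induction generalizing s with
  | base => omega
  | succ t ht ih =>
    obtain ⟨u, rfl⟩ := Nat.exists_eq_add_of_le' ht
    have he := H.sqIntegrable (vecMem_err (X := X) (u + 1))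
    have hv := H.sqIntegrable (vecMem_vAll (X := X) ht)
    have hw := H.sqIntegrable (vecMem_w_processFrom (X := X) ht le_rfl)
    set B := M.A * (1 - M.K (u + 1) * M.Cmat) with hB
    set D := M.A * M.K (u + 1) with hD
    have hexp : ∀ {κ : Type} {Z : Ω → κ → ℝ}, SqIntegrable μ Z →
        covMat μ (X.err (u + 2)) Z = B * covMat μ (X.err (u + 1)) Z
          - D * covMat μ (X.vAll (u + 1)) Z + covMat μ (X.w (u + 1)) Z := fun hZ => by
      rw [err_succ, covMat_add_left ((he.mulVec B).sub (hv.mulVec D)) hw hZ,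
        covMat_sub_left (he.mulVec B) (hv.mulVec D) hZ, covMat_mulVec_left _ he hZ,
        covMat_mulVec_left _ hv hZ]
    -- Fresh noise is uncorrelated with the past, so one step of the recursion preserves
    -- orthogonality to past vectors.
    have hpast : ∀ {κ : Type} {Z : Ω → κ → ℝ}, VecMem (X.primSpan (past n (u + 1))) Z →
        covMat μ (X.err (u + 1)) Z = 0 → covMat μ (X.err (u + 2)) Z = 0 := fun hZ h0 => by
      rw [hexp (H.sqIntegrable hZ), h0, ← covMat_transpose,
        H.covMat_eq_zero_of_disjoint (disjoint_past_noiseFrom _) hZ (vecMem_vAll ht),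
        ← covMat_transpose, H.covMat_eq_zero_of_disjoint (disjoint_past_processFrom _) hZ
          (vecMem_w_processFrom ht le_rfl)]
      simp
    rcases Nat.lt_succ_iff_lt_or_eq.1 hst with hlt | rfl
    · exact hpast (fun p => vecMem_y p.1 hs hlt p.2) (ih hs hlt)
    -- The newest measurement is the innovation plus `C x̂`. The predictor is a combination of older
    -- measurements, covered by the induction hypothesis. The innovation contributes `A (1 - K C) P
    -- Cᵀ - A K R`, which is zero by the normal equation.
    · have hxhat : covMat μ (X.err (u + 1)) (X.xhat (u + 1)) = 0 := by
        refine H.covMat_eq_zero_of_obsSpan (I := Finset.univ ×ˢ Finset.Icc 1 (u + 1 - 1))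
          (fun p hp => by simp at hp; omega) (vecMem_err _) (fun p hp => ?_) (vecMem_xhat _)
        simp only [Finset.mem_product, Finset.mem_univ, true_and, Finset.mem_Icc] at hp
        ext a b
        exact congr_fun (congr_fun (ih (s := p.2) hp.1 (by omega)) a) ⟨p.1, b⟩
      have hy : X.yAll (u + 1) = fun ω => (M.Cmat *ᵥ X.err (u + 1) ω + X.vAll (u + 1) ω)
          + M.Cmat *ᵥ X.xhat (u + 1) ω := by
        funext ω
        rw [yAll_eq, err, Matrix.mulVec_sub]
        abel
      have hxs := H.sqIntegrable (vecMem_xhat_past (X := X) (u + 1))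
      have hin := (he.mulVec M.Cmat).add hv
      have hes := H.sqIntegrable (vecMem_err (X := X) (u + 2))
      have hve : covMat μ (X.vAll (u + 1)) (X.err (u + 1)) = 0 := by
        rw [← covMat_transpose, H.covMat_err_vAll ht, Matrix.transpose_zero]
      have hwe : covMat μ (X.w (u + 1)) (X.err (u + 1)) = 0 := by
        rw [← covMat_transpose, H.covMat_err_w ht, Matrix.transpose_zero]
      rw [hy, covMat_add_right hin (hxs.mulVec _) hes,
        covMat_mulVec_right _ hxs hes, hpast (vecMem_xhat_past _) hxhat, hexp hin,
        covMat_add_right (he.mulVec _) hv he, covMat_add_right (he.mulVec _) hv hv,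
        covMat_add_right (he.mulVec _) hv hw, covMat_mulVec_right _ he he,
        covMat_mulVec_right _ he hv, covMat_mulVec_right _ he hw, hve, hwe,
        H.covMat_err_vAll ht, H.covMat_w_vAll ht, H.covMat_vAll ht, H.covMat_err ht]
      have hK := H.K_mul ht
      rw [Matrix.mul_add, Matrix.mul_assoc M.Cmat, ← eq_sub_iff_add_eq] at hK
      simp only [hB, hD, Matrix.zero_mul, add_zero, zero_add, Matrix.mul_sub, Matrix.sub_mul,
        Matrix.mul_assoc, hK, Matrix.mul_one]
      abel

lemma covMat_err_obs {t : ℕ} (ht : 1 ≤ t) {κ : Type*} {Z : Ω → κ → ℝ}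
    {I : Finset (Fin n × ℕ)} (hI : ∀ p ∈ I, 1 ≤ p.2 ∧ p.2 < t)
    (hZ : VecMem (X.obsSpan I) Z) : covMat μ (X.err t) Z = 0 := by
  refine H.covMat_eq_zero_of_obsSpan (fun p hp => (hI p hp).1) (vecMem_err t) (fun p hp => ?_) hZ
  ext a b
  exact congr_fun (congr_fun (H.covMat_err_yAll ht (hI p hp).1 (hI p hp).2) a) ⟨p.1, b⟩

end IsGaussianModel

end Primitives

/-! ### Covariances of the common error and the local innovations -/

namespace Primitives

variable {n dx : ℕ} {dy dz : Fin n → ℕ} {M : TeamModel n dx dy dz} {Ω : Type*}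
  {X : Primitives M Ω} [MeasurableSpace Ω] {μ : Measure Ω}

namespace IsGaussianModel

variable (H : X.IsGaussianModel μ)
include H

lemma covMat_comErr {t : ℕ} (ht : 1 ≤ t) : covMat μ (X.comErr t) (X.comErr t) = X.P0 μ t := by
  have := H.isProbabilityMeasure
  have hx := H.sqIntegrable (vecMem_xtilde (X := X) t)
  have hw := H.sqIntegrable (vecMem_wsum (X := X) t)
  have hxw : covMat μ (X.xtilde t) (X.wsum (M.G.diam - 1) 0 t) = 0 :=
    H.covMat_eq_zero_of_disjoint (disjoint_past_processFrom _) (vecMem_xtilde t) (vecMem_wsum t)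
  have hwx : covMat μ (X.wsum (M.G.diam - 1) 0 t) (X.xtilde t) = 0 := by
    rw [← covMat_transpose, hxw, Matrix.transpose_zero]
  have hP : covMat μ (X.xtilde t) (X.xtilde t) = M.P (M.G.delayedTime t) :=
    H.covMat_err (CommGraph.one_le_delayedTime t)
  have hs := (hx.mulVec (M.A ^ (t - M.G.delayedTime t))).add hw
  rw [funext (comErr_eq ht), covMat_add_left (hx.mulVec _) hw hs,
    covMat_add_right (hx.mulVec _) hw (hx.mulVec _), covMat_add_right (hx.mulVec _) hw hw,
    covMat_mulVec_left _ hx (hx.mulVec _), covMat_mulVec_left _ hx hw,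
    covMat_mulVec_right _ hx hx, covMat_mulVec_right _ hx hw, hxw, hwx, hP, P0]
  simp [Matrix.mul_assoc]

section Graph

variable (hG : M.G.StronglyConnected) (hn : 2 ≤ n)
include hG hn

lemma covMat_locTilde_left (t : ℕ) (i : Fin n) {κ : Type*} {Z : Ω → κ → ℝ}
    (hZ : SqIntegrable μ Z) : covMat μ (X.locTilde t i) Z =
      M.Cloc t i * covMat μ (X.xtilde t) Z + covMat μ (X.wloc t i) Z + covMat μ (X.vloc t i) Z := by
  have := H.isProbabilityMeasure
  have hx := H.sqIntegrable (vecMem_xtilde (X := X) t)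
  have hw := H.sqIntegrable (vecMem_wloc (X := X) hG hn t i)
  have hv := H.sqIntegrable (vecMem_vloc (X := X) hG hn t i)
  rw [funext (locTilde_eq hG hn t i), covMat_add_left ((hx.mulVec _).add hw) hv hZ,
    covMat_add_left (hx.mulVec _) hw hZ, covMat_mulVec_left _ hx hZ]

lemma covMat_xtilde_locTilde (t : ℕ) (i : Fin n) :
    covMat μ (X.xtilde t) (X.locTilde t i) = M.P (M.G.delayedTime t) * (M.Cloc t i)ᵀ := by
  rw [← covMat_transpose, H.covMat_locTilde_left hG hn _ _ (H.sqIntegrable (vecMem_xtilde t)),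
    ← covMat_transpose (X.xtilde t) (X.wloc t i), ← covMat_transpose (X.xtilde t) (X.vloc t i),
    H.covMat_eq_zero_of_disjoint (disjoint_past_processFrom _) (vecMem_xtilde t)
      (vecMem_wloc hG hn t i),
    H.covMat_eq_zero_of_disjoint (disjoint_past_noiseFrom _) (vecMem_xtilde t)
      (vecMem_vloc hG hn t i), ← covMat_transpose, Matrix.transpose_add, Matrix.transpose_add,
    Matrix.transpose_mul, Matrix.transpose_transpose]
  simp only [Matrix.transpose_zero, add_zero]
  exact congrArg (· * _) (H.covMat_err (CommGraph.one_le_delayedTime t))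

lemma covMat_process_locTilde {ι : Type*} (t : ℕ) (i : Fin n) {Y : Ω → ι → ℝ}
    (hY : VecMem (X.primSpan (processFrom n (M.G.delayedTime t))) Y) :
    covMat μ Y (X.locTilde t i) = covMat μ Y (X.wloc t i) := by
  rw [← covMat_transpose, H.covMat_locTilde_left hG hn _ _ (H.sqIntegrable hY),
    H.covMat_eq_zero_of_disjoint (disjoint_past_processFrom _) (vecMem_xtilde t) hY,
    ← covMat_transpose Y (X.vloc t i),
    H.covMat_eq_zero_of_disjoint (disjoint_processFrom_noiseFrom _ _) hY
      (vecMem_vloc hG hn t i), Matrix.mul_zero, zero_add, Matrix.transpose_zero, add_zero,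
    covMat_transpose]

lemma covMat_vloc_locTilde (t : ℕ) (i j : Fin n) :
    covMat μ (X.vloc t i) (X.locTilde t j) = covMat μ (X.vloc t i) (X.vloc t j) := by
  have hv := vecMem_vloc (X := X) hG hn t i
  rw [← covMat_transpose, H.covMat_locTilde_left hG hn _ _ (H.sqIntegrable hv),
    H.covMat_eq_zero_of_disjoint (disjoint_past_noiseFrom _) (vecMem_xtilde t) hv,
    H.covMat_eq_zero_of_disjoint (disjoint_processFrom_noiseFrom _ _)
      (vecMem_wloc hG hn t j) hv, Matrix.mul_zero, zero_add, zero_add, covMat_transpose]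

lemma covMat_locTilde (t : ℕ) (i j : Fin n) :
    covMat μ (X.locTilde t i) (X.locTilde t j) = X.SigmaHat μ t i j := by
  rw [H.covMat_locTilde_left hG hn t i (H.sqIntegrable (vecMem_locTilde hG hn t j)),
    H.covMat_xtilde_locTilde hG hn, H.covMat_process_locTilde hG hn _ _ (vecMem_wloc hG hn t i),
    H.covMat_vloc_locTilde hG hn, SigmaHat, Matrix.mul_assoc]

lemma covMat_comErr_locTilde {t : ℕ} (ht : 1 ≤ t) (i : Fin n) :
    covMat μ (X.comErr t) (X.locTilde t i) = X.ThetaHat μ t i := by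
  have := H.isProbabilityMeasure
  have hx := H.sqIntegrable (vecMem_xtilde (X := X) t)
  have hl := H.sqIntegrable (vecMem_locTilde (X := X) hG hn t i)
  rw [funext (comErr_eq ht), covMat_add_left (hx.mulVec _) (H.sqIntegrable (vecMem_wsum t)) hl,
    covMat_mulVec_left _ hx hl, H.covMat_xtilde_locTilde hG hn,
    H.covMat_process_locTilde hG hn _ _ (vecMem_wsum t), ThetaHat, Matrix.mul_assoc]

lemma covMat_xtilde_common (t : ℕ) {κ : Type*} {Z : Ω → κ → ℝ}
    (hZ : VecMem (X.obsSpan (M.G.common t)) Z) : covMat μ (X.xtilde t) Z = 0 :=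
  H.covMat_err_obs (CommGraph.one_le_delayedTime t) (fun _ hp => mem_common_time hG hn hp) hZ

lemma covMat_process_common {ι κ : Type*} (t : ℕ) {Y : Ω → ι → ℝ} {Z : Ω → κ → ℝ}
    (hY : VecMem (X.primSpan (processFrom n (M.G.delayedTime t))) Y)
    (hZ : VecMem (X.obsSpan (M.G.common t)) Z) : covMat μ Y Z = 0 :=
  H.covMat_eq_zero_of_disjoint (disjoint_past_processFrom _).symm hY
    (hZ.mono (obsSpan_common_le hG hn t))

lemma covMat_locTilde_common (t : ℕ) (i : Fin n) {κ : Type*} {Z : Ω → κ → ℝ}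
    (hZ : VecMem (X.obsSpan (M.G.common t)) Z) : covMat μ (X.locTilde t i) Z = 0 := by
  have hZp := hZ.mono (obsSpan_common_le hG hn t)
  rw [H.covMat_locTilde_left hG hn t i (H.sqIntegrable hZp), H.covMat_xtilde_common hG hn t hZ,
    H.covMat_process_common hG hn t (vecMem_wloc hG hn t i) hZ,
    H.covMat_eq_zero_of_disjoint (disjoint_past_noiseFrom _).symm (vecMem_vloc hG hn t i) hZp]
  simp

lemma covMat_comErr_common {t : ℕ} (ht : 1 ≤ t) {κ : Type*} {Z : Ω → κ → ℝ}
    (hZ : VecMem (X.obsSpan (M.G.common t)) Z) : covMat μ (X.comErr t) Z = 0 := by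
  have := H.isProbabilityMeasure
  have hx := H.sqIntegrable (vecMem_xtilde (X := X) t)
  have hZs := H.sqIntegrable (hZ.mono (obsSpan_common_le hG hn t))
  rw [funext (comErr_eq ht), covMat_add_left (hx.mulVec _) (H.sqIntegrable (vecMem_wsum t)) hZs,
    covMat_mulVec_left _ hx hZs, H.covMat_xtilde_common hG hn t hZ,
    H.covMat_process_common hG hn t (vecMem_wsum t) hZ]
  simp

/-- The state may be replaced by its common error, because `x̂^com` is uncorrelated with the
innovations. -/
lemma covMat_x_locTilde {t : ℕ} (ht : 1 ≤ t) (i : Fin n) :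
    covMat μ (X.x t) (X.locTilde t i) = X.ThetaHat μ t i := by
  have := H.isProbabilityMeasure
  have h : X.x t = fun ω => X.comErr t ω + X.xcom t ω := by
    funext ω
    simp [comErr]
  rw [h, covMat_add_left (H.sqIntegrable (vecMem_comErr ht))
    (H.sqIntegrable ((vecMem_xcom hG hn t).mono (obsSpan_common_le hG hn t)))
    (H.sqIntegrable (vecMem_locTilde hG hn t i)), H.covMat_comErr_locTilde hG hn ht,
    ← covMat_transpose (X.locTilde t i), H.covMat_locTilde_common hG hn t i (vecMem_xcom hG hn t),
    Matrix.transpose_zero, add_zero]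

lemma xhat_ae_eq_condExp (t : ℕ) : X.xhat (M.G.delayedTime t) =ᵐ[μ]
    μ[X.x (M.G.delayedTime t) | X.commonSigma t] :=
  H.ae_eq_condExp (fun _ hp => (mem_common_time hG hn hp).1) (vecMem_xtilde t)
    (vecMem_xhat_common hG hn t) ((vecMem_xhat_common hG hn t).mono (obsSpan_common_le hG hn t))
    fun _ hp => H.covMat_xtilde_common hG hn t (vecMem_obs hp)

lemma xcom_ae_eq_condExp {t : ℕ} (ht : 1 ≤ t) : X.xcom t =ᵐ[μ] μ[X.x t | X.commonSigma t] :=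
  H.ae_eq_condExp (fun _ hp => (mem_common_time hG hn hp).1) (vecMem_comErr ht)
    (vecMem_xcom hG hn t) ((vecMem_xcom hG hn t).mono (obsSpan_common_le hG hn t))
    fun _ hp => H.covMat_comErr_common hG hn ht (vecMem_obs hp)

lemma locHat_ae_eq_condExp (t : ℕ) (i : Fin n) :
    X.locHat t i =ᵐ[μ] μ[X.locVec t i | X.commonSigma t] :=
  H.ae_eq_condExp (fun _ hp => (mem_common_time hG hn hp).1) (vecMem_locTilde hG hn t i)
    (vecMem_locHat hG hn t i) ((vecMem_locHat hG hn t i).mono (obsSpan_common_le hG hn t))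
    fun _ hp => H.covMat_locTilde_common hG hn t i (vecMem_obs hp)

lemma covMat_vloc (t : ℕ) (i : Fin n) : covMat μ (X.vloc t i) (X.vloc t i) =
    Matrix.blockDiagonal' fun p : M.G.localInfo t i => M.R p.1.1 := by
  have h1 : ∀ p : M.G.localInfo t i, 1 ≤ p.1.2 := fun p =>
    (CommGraph.one_le_delayedTime t).trans (hG.delayedTime_le_of_mem_localInfo hn p.2).1
  ext ⟨p, a⟩ ⟨q, b⟩
  by_cases hpq : p = q
  · subst hpq
    rw [Matrix.blockDiagonal'_apply_eq, ← H.covMat_v_self p.1.1 (h1 p)]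
    rfl
  · rw [Matrix.blockDiagonal'_apply_ne _ _ _ hpq]
    exact congr_fun (congr_fun (H.covMat_v (h1 p) (h1 q) fun h => hpq (Subtype.ext h)) a) b

/-- Measurement noise alone gives definiteness: its covariance is block diagonal with blocks `R_j`.
The other two terms are merely semidefinite, as `Q` and `Σ_x` may be degenerate. -/
lemma posDef_SigmaHat (t : ℕ) (i : Fin n) : (X.SigmaHat μ t i i).PosDef := by
  have := H.isProbabilityMeasure
  refine Matrix.PosDef.posSemidef_add (Matrix.PosSemidef.add ?_ ?_) ?_
  · have := (H.posSemidef_P (CommGraph.one_le_delayedTime (G := M.G) t)).mul_mul_conjTranspose_same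
      (M.Cloc t i)
    rwa [Matrix.conjTranspose_eq_transpose_of_trivial] at this
  · exact covMat_posSemidef (H.sqIntegrable (vecMem_wloc hG hn t i))
  · have h := covMat_posSemidef (H.sqIntegrable (vecMem_vloc (X := X) hG hn t i))
    rw [H.covMat_vloc hG hn] at h ⊢
    exact h.posDef_blockDiagonal' fun p => H.posDef_R p.1.1

end Graph

end IsGaussianModel

end Primitives

/-! ### Quadratic costs and the Pythagorean theorem -/

section QuadraticForm

variable {Ω ι : Type*} [Fintype ι] [MeasurableSpace Ω] {μ : Measure Ω}
  {S : Matrix ι ι ℝ}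

lemma SqIntegrable.integrable_dotProduct {Y Z : Ω → ι → ℝ} (hY : SqIntegrable μ Y)
    (hZ : SqIntegrable μ Z) : Integrable (fun ω => Y ω ⬝ᵥ Z ω) μ :=
  integrable_finsetSum _ fun a _ => (hY a).integrable_mul (hZ a)

lemma SqIntegrable.integral_dotProduct {Y Z : Ω → ι → ℝ} (hY : SqIntegrable μ Y)
    (hZ : SqIntegrable μ Z) : ∫ ω, Y ω ⬝ᵥ Z ω ∂μ = ∑ a, ∫ ω, Y ω a * Z ω a ∂μ :=
  integral_finsetSum _ fun a _ => (hY a).integrable_mul (hZ a)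

lemma Matrix.IsHermitian.dotProduct_mulVec_comm (hS : S.IsHermitian) (u v : ι → ℝ) :
    u ⬝ᵥ (S *ᵥ v) = v ⬝ᵥ (S *ᵥ u) := by
  have hT : Sᵀ = S := by
    rw [← Matrix.conjTranspose_eq_transpose_of_trivial, hS.eq]
  rw [Matrix.dotProduct_mulVec, ← Matrix.mulVec_transpose, hT, dotProduct_comm]

lemma Matrix.PosSemidef.dotProduct_nonneg (hS : S.PosSemidef) (u : ι → ℝ) :
    0 ≤ u ⬝ᵥ (S *ᵥ u) := by
  simpa using hS.dotProduct_mulVec_nonneg u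

lemma Matrix.PosDef.eq_zero_of_dotProduct_eq_zero (hS : S.PosDef) {u : ι → ℝ}
    (h : u ⬝ᵥ (S *ᵥ u) = 0) : u = 0 := by
  by_contra hu
  have := hS.dotProduct_mulVec_pos hu
  simp [h] at this

lemma measurable_dotProduct_mulVec {Y Z : Ω → ι → ℝ} (hY : Measurable Y) (hZ : Measurable Z) :
    Measurable fun ω => Y ω ⬝ᵥ (S *ᵥ Z ω) := by
  simp only [dotProduct, Matrix.mulVec]
  fun_prop

/-- A random vector with a finite positive definite quadratic cost is square-integrable. -/
lemma Matrix.PosDef.sqIntegrable_of_lintegral_ne_top [DecidableEq ι] (hS : S.PosDef)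
    {Y : Ω → ι → ℝ} (hY : Measurable Y)
    (h : ∫⁻ ω, ENNReal.ofReal (Y ω ⬝ᵥ (S *ᵥ Y ω)) ∂μ ≠ ∞) : SqIntegrable μ Y := fun a => by
  obtain ⟨c, -, hc⟩ := hS.exists_sq_le
  have hYa : Measurable fun ω => Y ω a := by fun_prop
  have hq : Integrable (fun ω => Y ω ⬝ᵥ (S *ᵥ Y ω)) μ := by
    refine ⟨(measurable_dotProduct_mulVec hY hY).aestronglyMeasurable, ?_⟩
    rw [hasFiniteIntegral_iff_ofReal
      (Filter.Eventually.of_forall fun ω => hS.posSemidef.dotProduct_nonneg _)]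
    exact h.lt_top
  rw [memLp_two_iff_integrable_sq hYa.aestronglyMeasurable]
  refine (hq.const_mul c).mono' (hYa.pow_const 2).aestronglyMeasurable
    (Filter.Eventually.of_forall fun ω => ?_)
  rw [Real.norm_of_nonneg (sq_nonneg _)]
  exact hc _ a

/-- The Pythagorean theorem for a positive definite quadratic cost, in which the costs may be
infinite. -/
lemma Matrix.PosDef.lintegral_sub_eq_add [DecidableEq ι] (hS : S.PosDef) {E D : Ω → ι → ℝ}
    (hE : SqIntegrable μ E) (hEm : Measurable E) (hD : Measurable D)
    (horth : SqIntegrable μ D → ∫ ω, D ω ⬝ᵥ (S *ᵥ E ω) ∂μ = 0) :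
    ∫⁻ ω, ENNReal.ofReal ((E ω - D ω) ⬝ᵥ (S *ᵥ (E ω - D ω))) ∂μ =
      ENNReal.ofReal (∫ ω, E ω ⬝ᵥ (S *ᵥ E ω) ∂μ)
        + ∫⁻ ω, ENNReal.ofReal (D ω ⬝ᵥ (S *ᵥ D ω)) ∂μ := by
  have hnn : ∀ u, 0 ≤ u ⬝ᵥ (S *ᵥ u) := hS.posSemidef.dotProduct_nonneg
  by_cases hDs : SqIntegrable μ D
  · have hED := hE.sub hDs
    have hi1 := hED.integrable_dotProduct (hED.mulVec S)
    have hi2 := hE.integrable_dotProduct (hE.mulVec S)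
    have hi3 := hDs.integrable_dotProduct (hDs.mulVec S)
    have hi4 := hDs.integrable_dotProduct (hE.mulVec S)
    rw [← ofReal_integral_eq_lintegral_ofReal hi1 (Filter.Eventually.of_forall fun _ => hnn _),
      ← ofReal_integral_eq_lintegral_ofReal hi3 (Filter.Eventually.of_forall fun _ => hnn _),
      ← ENNReal.ofReal_add (integral_nonneg fun _ => hnn _) (integral_nonneg fun _ => hnn _)]
    congr 1
    have hpt : ∀ ω, (E ω - D ω) ⬝ᵥ (S *ᵥ (E ω - D ω)) =
        (E ω ⬝ᵥ (S *ᵥ E ω) + D ω ⬝ᵥ (S *ᵥ D ω)) - 2 * (D ω ⬝ᵥ (S *ᵥ E ω)) := fun ω => by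
      rw [Matrix.mulVec_sub, sub_dotProduct, dotProduct_sub, dotProduct_sub,
        hS.isHermitian.dotProduct_mulVec_comm (E ω) (D ω)]
      ring
    simp only [hpt]
    rw [integral_sub (f := fun ω => E ω ⬝ᵥ (S *ᵥ E ω) + D ω ⬝ᵥ (S *ᵥ D ω)) (hi2.add hi3)
      (hi4.const_mul 2), integral_add hi2 hi3,
      integral_const_mul, horth hDs, mul_zero, sub_zero]
  -- Otherwise both sides are infinite: a finite cost of `E - D` would make `E - D`, and with it `D
  -- = E - (E - D)`, square-integrable.
  · have h1 : ∫⁻ ω, ENNReal.ofReal (D ω ⬝ᵥ (S *ᵥ D ω)) ∂μ = ∞ := by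
      by_contra h
      exact hDs (hS.sqIntegrable_of_lintegral_ne_top hD h)
    have h2 : ∫⁻ ω, ENNReal.ofReal ((E ω - D ω) ⬝ᵥ (S *ᵥ (E ω - D ω))) ∂μ = ∞ := by
      by_contra h
      have h3 := hE.sub (hS.sqIntegrable_of_lintegral_ne_top (hEm.sub hD) h)
      exact hDs fun a => by simpa using h3 a
    rw [h1, h2, add_top]

end QuadraticForm

/-! ### Gain equations, orthogonality and the cost at one time -/

namespace TeamModel

variable {n dx : ℕ} {dy dz : Fin n → ℕ} (M : TeamModel n dx dy dz)

/-- The block row `S_{i•}` of the weight matrix. -/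
def Srow (i : Fin n) : Matrix (Fin (dz i)) (Σ i, Fin (dz i)) ℝ :=
  M.S.submatrix (fun a => ⟨i, a⟩) id

variable {M}

lemma Srow_mul (i : Fin n) {κ : Type*} (N : Matrix (Σ i, Fin (dz i)) κ ℝ) :
    M.Srow i * N = ∑ j, M.Sblock i j * N.submatrix (fun b => ⟨j, b⟩) id := by
  ext a q
  rw [Matrix.sum_apply, Matrix.mul_apply, Fintype.sum_sigma]
  rfl

lemma vecGains_injective {t : ℕ} : Function.Injective (M.vecGains (t := t)) := fun F F' h => by
  ext i a q
  exact congr_fun h ⟨i, (q, a)⟩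

lemma vecGains_surjective {t : ℕ} : Function.Surjective (M.vecGains (t := t)) := fun f =>
  ⟨fun i => Matrix.of fun a q => f ⟨i, (q, a)⟩, rfl⟩

lemma vecGains_zero {t : ℕ} : M.vecGains (t := t) (fun _ => 0) = 0 := rfl

end TeamModel

namespace Primitives

variable {n dx : ℕ} {dy dz : Fin n → ℕ} {M : TeamModel n dx dy dz} {Ω : Type*}
  {X : Primitives M Ω}

variable (X) in
/-- The stacked vector of the `F_i Ĩ^loc_i(t)`. -/
def teamDev {t : ℕ} (F : M.Gains t) (ω : Ω) : (Σ i, Fin (dz i)) → ℝ :=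
  fun p => (F p.1 *ᵥ X.locTilde t p.1 ω) p.2

variable (X) in
/-- The stacked estimation error of the estimates `L_i x̂^com(t) + F_i Ĩ^loc_i(t)`. -/
def linErr {t : ℕ} (F : M.Gains t) (ω : Ω) : (Σ i, Fin (dz i)) → ℝ :=
  M.Lmat *ᵥ X.comErr t ω - X.teamDev F ω

variable (X) in
/-- The estimate `L_i x̂^com(t) + F_i Ĩ^loc_i(t)`. -/
def linEst {t : ℕ} (F : M.Gains t) (i : Fin n) (ω : Ω) : Fin (dz i) → ℝ :=
  M.L i *ᵥ X.xcom t ω + F i *ᵥ X.locTilde t i ω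

lemma Lmat_mulVec_sub_linEst {t : ℕ} (F : M.Gains t) (ω : Ω) :
    (M.Lmat *ᵥ X.x t ω - fun p => X.linEst F p.1 ω p.2) = X.linErr F ω := by
  have h : (fun p : Σ i, Fin (dz i) => X.linEst F p.1 ω p.2) =
      M.Lmat *ᵥ X.xcom t ω + X.teamDev F ω := rfl
  rw [h, linErr, comErr, Matrix.mulVec_sub]
  abel

section Graph

variable (hG : M.G.StronglyConnected) (hn : 2 ≤ n)
include hG hn

lemma vecMem_teamDev {t : ℕ} (F : M.Gains t) :
    VecMem (X.primSpan Set.univ) (X.teamDev F) := fun p =>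
  (vecMem_locTilde hG hn t p.1).mulVec (F p.1) p.2

lemma vecMem_linErr {t : ℕ} (ht : 1 ≤ t) (F : M.Gains t) :
    VecMem (X.primSpan Set.univ) (X.linErr F) :=
  ((vecMem_comErr ht).mulVec M.Lmat).sub (vecMem_teamDev hG hn F)

/-- The linear estimates are linear functions of the information of the agents. -/
lemma exists_linear_rule {t : ℕ} (F : M.Gains t) (i : Fin n) :
    ∃ r : M.InfoSpace t i →ₗ[ℝ] (Fin (dz i) → ℝ), ∀ ω, r (X.infoVec t i ω) = X.linEst F i ω := by
  have h : VecMem (X.obsSpan (M.G.info t i)) (X.linEst F i) :=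
    (((vecMem_xcom hG hn t).mono (obsSpan_mono (hG.common_subset_info t i))).mulVec _).add
      ((vecMem_locTilde_obsSpan hG hn t i).mulVec _)
  choose r hr using fun a => exists_linearMap_of_mem_obsSpan (h a)
  exact ⟨LinearMap.pi r, fun ω => funext fun a => (hr a ω).symm⟩

/-- Some strategy with linear rules produces the linear estimates. -/
lemma exists_linear_strategy (F : (t : ℕ) → M.Gains t) : ∃ g : M.Strategy,
    (∀ i t, IsLinearMap ℝ (g.rule i t)) ∧ ∀ i t ω, X.estimate g i t ω = X.linEst (F t) i ω := by
  choose r hr using fun i t => exists_linear_rule (X := X) hG hn (F t) i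
  exact ⟨⟨fun i t => r i t, fun i t =>
    (LinearMap.continuous_of_finiteDimensional (r i t)).measurable⟩,
    fun i t => (r i t).isLinear, hr⟩

end Graph

variable [MeasurableSpace Ω] {μ : Measure Ω}

lemma eta_eq (t : ℕ) :
    X.eta μ t = M.vecGains fun i => M.Srow i * (M.Lmat * X.ThetaHat μ t i) := by
  simp only [eta, TeamModel.Srow, Matrix.mul_assoc]

/-- Blockwise this is the identity `(B ⊗ A) vec F = vec (A F Bᵀ)` for column-by-column
vectorization. -/
lemma Gam_mulVec {t : ℕ} (F : M.Gains t) : X.Gam μ t *ᵥ M.vecGains F =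
    M.vecGains fun i => ∑ j, M.Sblock i j * F j * (X.SigmaHat μ t i j)ᵀ := by
  ext ⟨i, p⟩
  have h : ∀ j, (∑ q, Matrix.kronecker (X.SigmaHat μ t i j) (M.Sblock i j) p q * (F j).vec q) =
      (M.Sblock i j * F j * (X.SigmaHat μ t i j)ᵀ).vec p := fun j => by
    rw [← Matrix.kronecker_mulVec_vec]
    rfl
  have h2 : (X.Gam μ t *ᵥ M.vecGains F) ⟨i, p⟩ = ∑ j, ∑ q,
      Matrix.kronecker (X.SigmaHat μ t i j) (M.Sblock i j) p q * (F j).vec q := by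
    rw [Matrix.mulVec, dotProduct, Fintype.sum_sigma]
    rfl
  rw [h2, TeamModel.vecGains, Matrix.vec_sum, Finset.sum_apply]
  exact Finset.sum_congr rfl fun j _ => h j

namespace IsGaussianModel

variable (H : X.IsGaussianModel μ) (hG : M.G.StronglyConnected) (hn : 2 ≤ n)
include H hG hn

lemma SigmaHat_transpose (t : ℕ) (i j : Fin n) : (X.SigmaHat μ t i j)ᵀ = X.SigmaHat μ t j i := by
  rw [← H.covMat_locTilde hG hn, ← H.covMat_locTilde hG hn, covMat_transpose]

lemma gainEquations_iff {t : ℕ} (F : M.Gains t) :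
    X.GainEquations μ t F ↔ X.Gam μ t *ᵥ M.vecGains F = X.eta μ t := by
  rw [Gam_mulVec, eta_eq, TeamModel.vecGains_injective.eq_iff, funext_iff]
  refine forall_congr' fun i => ?_
  rw [TeamModel.Srow_mul, ← sub_eq_zero (a := ∑ j, M.Sblock i j * F j * _),
    ← Finset.sum_sub_distrib]
  simp only [H.SigmaHat_transpose hG hn]
  refine Eq.congr (Finset.sum_congr rfl fun j _ => ?_) rfl
  rw [Matrix.mul_assoc _ (M.L j)]
  rfl

lemma covMat_teamDev_locTilde {t : ℕ} (F : M.Gains t) (i : Fin n) :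
    M.Srow i * covMat μ (X.teamDev F) (X.locTilde t i) =
      ∑ j, M.Sblock i j * F j * (X.SigmaHat μ t i j)ᵀ := by
  have := H.isProbabilityMeasure
  rw [TeamModel.Srow_mul]
  refine Finset.sum_congr rfl fun j _ => ?_
  have hj := H.sqIntegrable (vecMem_locTilde (X := X) hG hn t j)
  have hi := H.sqIntegrable (vecMem_locTilde (X := X) hG hn t i)
  rw [H.SigmaHat_transpose hG hn, ← H.covMat_locTilde hG hn, Matrix.mul_assoc,
    ← covMat_mulVec_left _ hj hi]
  rfl

/-- The covariance expands to `S_{i•} L Θ̂_i - ∑_j S_ij F_j Σ̂_ji`, the residual of the `i`-th gain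
equation. -/
lemma covMat_linErr_locTilde {t : ℕ} (ht : 1 ≤ t) {F : M.Gains t} (hF : X.GainEquations μ t F)
    (i : Fin n) : covMat μ (fun ω => M.Srow i *ᵥ X.linErr F ω) (X.locTilde t i) = 0 := by
  have := H.isProbabilityMeasure
  have hl := H.sqIntegrable (vecMem_locTilde (X := X) hG hn t i)
  have hc := H.sqIntegrable (vecMem_comErr (X := X) ht)
  have hu := H.sqIntegrable (vecMem_teamDev (X := X) hG hn F)
  have he : covMat μ (X.linErr F) (X.locTilde t i) =
      M.Lmat * X.ThetaHat μ t i - covMat μ (X.teamDev F) (X.locTilde t i) := by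
    rw [← H.covMat_comErr_locTilde hG hn ht, ← covMat_mulVec_left _ hc hl,
      ← covMat_sub_left (hc.mulVec _) hu hl]
    rfl
  rw [covMat_mulVec_left _ (H.sqIntegrable (vecMem_linErr hG hn ht F)) hl, he, Matrix.mul_sub,
    H.covMat_teamDev_locTilde hG hn, sub_eq_zero]
  have h := (H.gainEquations_iff hG hn F).1 hF
  rw [Gam_mulVec, eta_eq] at h
  exact (congr_fun (TeamModel.vecGains_injective h) i).symm

/-- No condition on the gains is needed: the common error and all innovations are separately
uncorrelated with common measurements. -/
lemma covMat_linErr_common {t : ℕ} (ht : 1 ≤ t) (F : M.Gains t) {κ : Type*} {Z : Ω → κ → ℝ}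
    (hZ : VecMem (X.obsSpan (M.G.common t)) Z) : covMat μ (X.linErr F) Z = 0 := by
  have := H.isProbabilityMeasure
  have hc := H.sqIntegrable (vecMem_comErr (X := X) ht)
  have hZs := H.sqIntegrable (hZ.mono (obsSpan_common_le hG hn t))
  have hu : covMat μ (X.teamDev F) Z = 0 := by
    ext p b
    have h := covMat_mulVec_left (F p.1)
      (H.sqIntegrable (vecMem_locTilde (X := X) hG hn t p.1)) hZs
    rw [H.covMat_locTilde_common hG hn t p.1 hZ, Matrix.mul_zero] at h
    exact congr_fun (congr_fun h p.2) b
  have h : covMat μ (X.linErr F) Z = M.Lmat * covMat μ (X.comErr t) Z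
      - covMat μ (X.teamDev F) Z := by
    rw [← covMat_mulVec_left _ hc hZs, ← covMat_sub_left (hc.mulVec _)
      (H.sqIntegrable (vecMem_teamDev hG hn F)) hZs]
    rfl
  rw [h, H.covMat_comErr_common hG hn ht hZ, hu, Matrix.mul_zero, sub_zero]

/-- The weighted estimation error of agent `i` is independent of the information of agent `i`. -/
lemma indepFun_linErr_infoVec {t : ℕ} (ht : 1 ≤ t) {F : M.Gains t}
    (hF : X.GainEquations μ t F) (i : Fin n) :
    IndepFun (fun ω => M.Srow i *ᵥ X.linErr F ω) (X.infoVec t i) μ := by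
  have := H.isProbabilityMeasure
  have he := vecMem_linErr (X := X) hG hn ht F
  have hce : ∀ {κ : Type} {Z : Ω → κ → ℝ}, VecMem (X.obsSpan (M.G.common t)) Z →
      covMat μ (fun ω => M.Srow i *ᵥ X.linErr F ω) Z = 0 := fun hZ => by
    rw [covMat_mulVec_left _ (H.sqIntegrable he)
      (H.sqIntegrable (hZ.mono (obsSpan_common_le hG hn t))),
      H.covMat_linErr_common hG hn ht F hZ, Matrix.mul_zero]
  refine H.indepFun_obsVec (fun p hp => (M.G.time_of_mem_info hp).1) (he.mulVec _) fun p hp => ?_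
  -- A measurement outside the common part is an innovation coordinate plus its common prediction.
  -- The gain equations handle the former, the common measurements the latter.
  by_cases hpc : p ∈ M.G.common t
  · exact hce (vecMem_obs hpc)
  · have hpl : p ∈ M.G.localInfo t i := Finset.mem_sdiff.2 ⟨hp, hpc⟩
    ext a b
    have h1 : (fun ω => X.y p.1 p.2 ω b) = (fun ω => X.locTilde t i ω ⟨⟨p, hpl⟩, b⟩)
        + fun ω => X.locHat t i ω ⟨⟨p, hpl⟩, b⟩ := by
      funext ω
      simp [locTilde, locVec]
    rw [covMat_apply, h1, covariance_add_right (H.memLp (he.mulVec _ a))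
      (H.memLp (vecMem_locTilde hG hn t i _))
      (H.memLp (obsSpan_common_le hG hn t (vecMem_locHat hG hn t i _)))]
    have h2 := congr_fun (congr_fun (H.covMat_linErr_locTilde hG hn ht hF i) a) ⟨⟨p, hpl⟩, b⟩
    have h3 := congr_fun (congr_fun (hce (vecMem_locHat (X := X) hG hn t i)) a) ⟨⟨p, hpl⟩, b⟩
    rw [covMat_apply] at h2 h3
    rw [h2, h3]
    simp

/-- Used for three choices of `E`: the team deviation gives the quadratic form of `Γ`, the optimal
error gives zero, and `L` times the common error gives `ηᵀ vec F`. -/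
lemma integral_teamDev_dotProduct {t : ℕ} (F : M.Gains t) {E : Ω → (Σ i, Fin (dz i)) → ℝ}
    (hE : VecMem (X.primSpan Set.univ) E) :
    ∫ ω, X.teamDev F ω ⬝ᵥ (M.S *ᵥ E ω) ∂μ = M.vecGains F ⬝ᵥ M.vecGains fun i =>
      covMat μ (fun ω => M.Srow i *ᵥ E ω) (X.locTilde t i) := by
  have := H.isProbabilityMeasure
  have hu := vecMem_teamDev (X := X) hG hn F
  have hSE := hE.mulVec M.S
  rw [(H.sqIntegrable hu).integral_dotProduct (H.sqIntegrable hSE), dotProduct,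
    Fintype.sum_sigma, Fintype.sum_sigma]
  refine Finset.sum_congr rfl fun i _ => ?_
  rw [Fintype.sum_prod_type_right]
  refine Finset.sum_congr rfl fun a _ => ?_
  have hl := vecMem_locTilde (X := X) hG hn t i
  have h := covMat_mulVec_left (F i) (H.sqIntegrable hl)
    (H.sqIntegrable (hE.mulVec (M.Srow i)))
  rw [← covMat_transpose _ (X.locTilde t i)] at h
  exact (H.integral_mul_eq_covariance (hu ⟨i, a⟩) (hSE ⟨i, a⟩)).trans
    (congr_fun (congr_fun h a) a)

/-- The matrix `Γ(t)` is invertible. -/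
lemma isUnit_det_Gam (hS : M.S.PosDef) (t : ℕ) : IsUnit (X.Gam μ t).det := by
  have := H.isProbabilityMeasure
  rw [← Matrix.isUnit_iff_isUnit_det, ← Matrix.mulVec_injective_iff_isUnit]
  rw [← Matrix.coe_mulVecLin, injective_iff_map_eq_zero]
  intro f hf
  obtain ⟨F, rfl⟩ := TeamModel.vecGains_surjective f
  rw [Matrix.mulVecLin_apply] at hf
  have hu := vecMem_teamDev (X := X) hG hn F
  have hus := H.sqIntegrable hu
  -- If `Γ f = 0`, then `fᵀ Γ f` is zero. It is the expected `S`-cost of the team deviation, which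
  -- therefore vanishes almost surely.
  have h0 : ∫ ω, X.teamDev F ω ⬝ᵥ (M.S *ᵥ X.teamDev F ω) ∂μ = 0 := by
    have hc : (fun i => covMat μ (fun ω => M.Srow i *ᵥ X.teamDev F ω) (X.locTilde t i))
        = fun i => ∑ j, M.Sblock i j * F j * (X.SigmaHat μ t i j)ᵀ := by
      funext i
      rw [covMat_mulVec_left _ hus (H.sqIntegrable (vecMem_locTilde hG hn t i)),
        H.covMat_teamDev_locTilde hG hn]
    rw [H.integral_teamDev_dotProduct hG hn F hu, hc, ← Gam_mulVec, hf, dotProduct_zero]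
  have hae : ∀ᵐ ω ∂μ, X.teamDev F ω = 0 := by
    have h := (integral_eq_zero_iff_of_nonneg
      (fun ω => hS.posSemidef.dotProduct_nonneg (X.teamDev F ω))
      (hus.integrable_dotProduct (hus.mulVec _))).1 h0
    filter_upwards [h] with ω hω
    exact hS.eq_zero_of_dotProduct_eq_zero hω
  rw [← TeamModel.vecGains_zero]
  congr 1
  funext i
  ext a q
  have hl := H.sqIntegrable (vecMem_locTilde (X := X) hG hn t i)
  -- The diagonal entries are the variances of the coordinates of `F_i Ĩ_i`. As `Σ̂_ii` is definite,
  -- their vanishing kills each row of `F_i`.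
  have hvar : (F i * X.SigmaHat μ t i i * (F i)ᵀ) a a = 0 := by
    rw [← H.covMat_locTilde hG hn, Matrix.mul_assoc, ← covMat_mulVec_right _ hl hl,
      ← covMat_mulVec_left _ hl (hl.mulVec _), covMat_apply,
      ← H.integral_mul_eq_covariance ((vecMem_locTilde hG hn t i).mulVec (F i) a)
        ((vecMem_locTilde hG hn t i).mulVec (F i) a)]
    refine integral_eq_zero_of_ae ?_
    filter_upwards [hae] with ω hω
    have : (F i *ᵥ X.locTilde t i ω) a = 0 := congr_fun hω ⟨i, a⟩
    simp [this]
  have hquad : F i a ⬝ᵥ (X.SigmaHat μ t i i *ᵥ F i a) = 0 := by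
    rw [Matrix.dotProduct_mulVec, ← hvar]
    rfl
  exact congr_fun ((H.posDef_SigmaHat hG hn t i).eq_zero_of_dotProduct_eq_zero hquad) q

/-- The weighted error is orthogonal to all functions of the information of the agents. -/
lemma integral_dotProduct_linErr_eq_zero {t : ℕ} (ht : 1 ≤ t) {F : M.Gains t}
    (hF : X.GainEquations μ t F) {d : (i : Fin n) → M.InfoSpace t i → Fin (dz i) → ℝ}
    (hd : ∀ i, Measurable (d i))
    (hD : SqIntegrable μ fun ω (p : Σ i, Fin (dz i)) => d p.1 (X.infoVec t p.1 ω) p.2) :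
    ∫ ω, (fun p : Σ i, Fin (dz i) => d p.1 (X.infoVec t p.1 ω) p.2) ⬝ᵥ
      (M.S *ᵥ X.linErr F ω) ∂μ = 0 := by
  have hSE := (vecMem_linErr (X := X) hG hn ht F).mulVec M.S
  rw [hD.integral_dotProduct (H.sqIntegrable hSE)]
  -- Coordinate `p` of `S e` lies in the block row of agent `p.1` and is paired with a function of
  -- that same agent's information. Independence factors the expectation, and one factor has mean
  -- zero.
  refine Finset.sum_eq_zero fun p _ => ?_
  have hind : IndepFun (fun ω => d p.1 (X.infoVec t p.1 ω) p.2)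
      (fun ω => (M.S *ᵥ X.linErr F ω) p) μ :=
    ((H.indepFun_linErr_infoVec hG hn ht hF p.1).comp
      (φ := fun z : Fin (dz p.1) → ℝ => z p.2) (ψ := fun z => d p.1 z p.2)
      (measurable_pi_apply p.2) ((measurable_pi_apply p.2).comp (hd p.1))).symm
  rw [hind.integral_fun_mul_eq_mul_integral (hD p).aestronglyMeasurable
    (H.memLp (hSE p)).aestronglyMeasurable, H.integral_eq_zero (hSE p), mul_zero]

omit hG hn in
lemma integral_dotProduct_eq_trace {ι : Type*} [Fintype ι] {Y Z : Ω → ι → ℝ}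
    (hY : VecMem (X.primSpan Set.univ) Y) (hZ : VecMem (X.primSpan Set.univ) Z) :
    ∫ ω, Y ω ⬝ᵥ Z ω ∂μ = (covMat μ Y Z).trace := by
  rw [(H.sqIntegrable hY).integral_dotProduct (H.sqIntegrable hZ)]
  exact Finset.sum_congr rfl fun a _ => H.integral_mul_eq_covariance (hY a) (hZ a)

/-- The minimal mean-squared error at time `t`. -/
lemma integral_linErr (hS : M.S.PosDef) {t : ℕ} (ht : 1 ≤ t) {F : M.Gains t}
    (hF : X.GainEquations μ t F) :
    ∫ ω, X.linErr F ω ⬝ᵥ (M.S *ᵥ X.linErr F ω) ∂μ =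
      (M.Lmatᵀ * M.S * M.Lmat * X.P0 μ t).trace - X.eta μ t ⬝ᵥ M.vecGains F := by
  have := H.isProbabilityMeasure
  have hc := vecMem_comErr (X := X) ht
  have hcs := H.sqIntegrable hc
  have hLc := hc.mulVec M.Lmat
  have hu := vecMem_teamDev (X := X) hG hn F
  have he := vecMem_linErr (X := X) hG hn ht F
  have hLcs := H.sqIntegrable hLc
  have hus := H.sqIntegrable hu
  have h1 : ∫ ω, X.teamDev F ω ⬝ᵥ (M.S *ᵥ X.linErr F ω) ∂μ = 0 := by
    rw [H.integral_teamDev_dotProduct hG hn F he]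
    simp only [H.covMat_linErr_locTilde hG hn ht hF]
    rw [TeamModel.vecGains_zero, dotProduct_zero]
  have h2 : ∫ ω, X.teamDev F ω ⬝ᵥ (M.S *ᵥ (M.Lmat *ᵥ X.comErr t ω)) ∂μ =
      X.eta μ t ⬝ᵥ M.vecGains F := by
    rw [H.integral_teamDev_dotProduct hG hn F hLc, dotProduct_comm, eta_eq]
    congr 2
    funext i
    have hl := H.sqIntegrable (vecMem_locTilde (X := X) hG hn t i)
    rw [covMat_mulVec_left _ hLcs hl, covMat_mulVec_left _ hcs hl,
      H.covMat_comErr_locTilde hG hn ht]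
  have h3 : ∫ ω, (M.Lmat *ᵥ X.comErr t ω) ⬝ᵥ (M.S *ᵥ (M.Lmat *ᵥ X.comErr t ω)) ∂μ =
      (M.Lmatᵀ * M.S * M.Lmat * X.P0 μ t).trace := by
    have hT : M.Sᵀ = M.S := by
      rw [← Matrix.conjTranspose_eq_transpose_of_trivial, hS.isHermitian.eq]
    rw [H.integral_dotProduct_eq_trace hLc (hLc.mulVec M.S), covMat_mulVec_right _ hLcs hLcs,
      covMat_mulVec_left _ hcs hLcs, covMat_mulVec_right _ hcs hcs, H.covMat_comErr ht, hT,
      ← Matrix.mul_assoc, Matrix.mul_assoc (M.Lmat * X.P0 μ t), Matrix.mul_assoc M.Lmat,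
      Matrix.trace_mul_comm M.Lmat, Matrix.mul_assoc (X.P0 μ t), Matrix.trace_mul_comm]
  -- With `e = L c - u`, for the common error `c` and the team deviation `u`, only the left factor
  -- of the last term is kept unexpanded as `uᵀ S e`, whose mean is zero.
  have hpt : ∀ ω, X.linErr F ω ⬝ᵥ (M.S *ᵥ X.linErr F ω) =
      ((M.Lmat *ᵥ X.comErr t ω) ⬝ᵥ (M.S *ᵥ (M.Lmat *ᵥ X.comErr t ω))
        - X.teamDev F ω ⬝ᵥ (M.S *ᵥ (M.Lmat *ᵥ X.comErr t ω)))
        - X.teamDev F ω ⬝ᵥ (M.S *ᵥ X.linErr F ω) := fun ω => by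
    simp only [linErr, Matrix.mulVec_sub, sub_dotProduct, dotProduct_sub]
    rw [hS.isHermitian.dotProduct_mulVec_comm (M.Lmat *ᵥ X.comErr t ω) (X.teamDev F ω)]
  have hi1 := hLcs.integrable_dotProduct (hLcs.mulVec M.S)
  have hi2 := hus.integrable_dotProduct (hLcs.mulVec M.S)
  have hi3 := hus.integrable_dotProduct ((H.sqIntegrable he).mulVec M.S)
  simp only [hpt]
  rw [integral_sub (f := fun ω => (M.Lmat *ᵥ X.comErr t ω) ⬝ᵥ (M.S *ᵥ (M.Lmat *ᵥ X.comErr t ω))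
    - X.teamDev F ω ⬝ᵥ (M.S *ᵥ (M.Lmat *ᵥ X.comErr t ω))) (hi1.sub hi2) hi3,
    integral_sub hi1 hi2, h1, h2, h3, sub_zero]

omit hG hn in
lemma measurable_infoVec (t : ℕ) (i : Fin n) : Measurable (X.infoVec t i) :=
  H.measurable_obsVec fun _ hp => (M.G.time_of_mem_info hp).1

omit hG hn in
lemma measurable_estimate (g : M.Strategy) (i : Fin n) (t : ℕ) :
    Measurable (X.estimate g i t) :=
  (g.measurable_rule i t).comp (H.measurable_infoVec t i)

lemma measurable_linEst {t : ℕ} (F : M.Gains t) (i : Fin n) : Measurable (X.linEst F i) := by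
  obtain ⟨r, hr⟩ := exists_linear_rule (X := X) hG hn F i
  rw [← funext hr]
  exact (LinearMap.continuous_of_finiteDimensional r).measurable.comp (H.measurable_infoVec t i)

omit hG hn in
lemma measurable_cost (g : M.Strategy) (t : ℕ) :
    Measurable fun ω => M.cost (X.x t ω) fun i => X.estimate g i t ω := by
  have hx := H.measurable_vec ((vecMem_x (X := X) t).mulVec M.Lmat)
  have hE : Measurable fun ω => M.Lmat *ᵥ X.x t ω - fun p => X.estimate g p.1 t ω p.2 :=
    hx.sub (measurable_pi_lambda _ fun p =>
      (measurable_pi_apply p.2).comp (H.measurable_estimate g p.1 t))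
  exact measurable_dotProduct_mulVec hE hE

/-- The mean-squared error of a strategy at time `t`. -/
lemma lintegral_cost (hS : M.S.PosDef) {t : ℕ} (ht : 1 ≤ t) {F : M.Gains t}
    (hF : X.GainEquations μ t F) (g : M.Strategy) :
    ∫⁻ ω, ENNReal.ofReal (M.cost (X.x t ω) fun i => X.estimate g i t ω) ∂μ =
      ENNReal.ofReal (∫ ω, X.linErr F ω ⬝ᵥ (M.S *ᵥ X.linErr F ω) ∂μ) +
      ∫⁻ ω, ENNReal.ofReal ((fun p : Σ i, Fin (dz i) =>
          X.estimate g p.1 t ω p.2 - X.linEst F p.1 ω p.2) ⬝ᵥ (M.S *ᵥ fun p =>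
          X.estimate g p.1 t ω p.2 - X.linEst F p.1 ω p.2)) ∂μ := by
  choose r hr using exists_linear_rule (X := X) hG hn F
  have he := vecMem_linErr (X := X) hG hn ht F
  -- The deviation is written as a rule on each agent's information, the form in which orthogonality
  -- applies.
  let d : (i : Fin n) → M.InfoSpace t i → Fin (dz i) → ℝ := fun i z => g.rule i t z - r i z
  have hd : ∀ i, Measurable (d i) := fun i =>
    (g.measurable_rule i t).sub (LinearMap.continuous_of_finiteDimensional (r i)).measurable
  have hdD : (fun ω (p : Σ i, Fin (dz i)) => d p.1 (X.infoVec t p.1 ω) p.2) =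
      fun ω p => X.estimate g p.1 t ω p.2 - X.linEst F p.1 ω p.2 := by
    funext ω p
    simp [d, hr, estimate]
  have hD : Measurable fun ω (p : Σ i, Fin (dz i)) =>
      X.estimate g p.1 t ω p.2 - X.linEst F p.1 ω p.2 :=
    measurable_pi_lambda _ fun p => (measurable_pi_apply p.2).comp
      ((H.measurable_estimate g p.1 t).sub (H.measurable_linEst hG hn F p.1))
  rw [← hS.lintegral_sub_eq_add (H.sqIntegrable he) (H.measurable_vec he) hD fun hDs => ?_]
  · refine lintegral_congr fun ω => ?_
    have h : (M.Lmat *ᵥ X.x t ω - fun p => X.estimate g p.1 t ω p.2) = X.linErr F ω -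
        fun p => X.estimate g p.1 t ω p.2 - X.linEst F p.1 ω p.2 := by
      rw [← Lmat_mulVec_sub_linEst]
      funext p
      simp
    rw [TeamModel.cost, h]
  · rw [← hdD] at hDs
    have := H.integral_dotProduct_linErr_eq_zero hG hn ht hF hd hDs
    rw [← this]
    refine integral_congr_ae (Filter.Eventually.of_forall fun ω => ?_)
    exact congrArg (· ⬝ᵥ _) (congr_fun hdD ω).symm

end IsGaussianModel

end Primitives

/-! ### The total cost and its minimizers -/

namespace Primitives.IsGaussianModel

variable {n dx : ℕ} {dy dz : Fin n → ℕ} {M : TeamModel n dx dy dz} {Ω : Type*}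
  {X : Primitives M Ω} [MeasurableSpace Ω] {μ : Measure Ω} (H : X.IsGaussianModel μ)
  (hG : M.G.StronglyConnected) (hn : 2 ≤ n) (hS : M.S.PosDef)
include H hS

lemma J_eq_sum (T : ℕ) (g : M.Strategy) : X.J μ T g = ∑ t ∈ Finset.Icc 1 T,
    ∫⁻ ω, ENNReal.ofReal (M.cost (X.x t ω) fun i => X.estimate g i t ω) ∂μ := by
  rw [← lintegral_finsetSum _ fun t _ => (H.measurable_cost g t).ennreal_ofReal]
  refine lintegral_congr fun ω => ?_
  exact ENNReal.ofReal_sum_of_nonneg fun t _ => hS.posSemidef.dotProduct_nonneg _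

include hG hn

/-- The team error of a strategy is the error of the linear strategy plus the cost of the
deviation from it. -/
lemma J_eq_add {T : ℕ} {F : (t : ℕ) → M.Gains t}
    (hF : ∀ t, 1 ≤ t → t ≤ T → X.GainEquations μ t (F t)) (g : M.Strategy) :
    X.J μ T g = ENNReal.ofReal (∑ t ∈ Finset.Icc 1 T,
        ∫ ω, X.linErr (F t) ω ⬝ᵥ (M.S *ᵥ X.linErr (F t) ω) ∂μ) +
      ∑ t ∈ Finset.Icc 1 T, ∫⁻ ω, ENNReal.ofReal ((fun p : Σ i, Fin (dz i) =>
          X.estimate g p.1 t ω p.2 - X.linEst (F t) p.1 ω p.2) ⬝ᵥ (M.S *ᵥ fun p =>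
          X.estimate g p.1 t ω p.2 - X.linEst (F t) p.1 ω p.2)) ∂μ := by
  rw [H.J_eq_sum hS, ENNReal.ofReal_sum_of_nonneg fun t _ =>
    integral_nonneg fun ω => hS.posSemidef.dotProduct_nonneg _, ← Finset.sum_add_distrib]
  refine Finset.sum_congr rfl fun t ht => ?_
  rw [Finset.mem_Icc] at ht
  exact H.lintegral_cost hG hn hS ht.1 (hF t ht.1 ht.2) g

lemma sum_deviation_eq_zero_iff {T : ℕ} (F : (t : ℕ) → M.Gains t) (g : M.Strategy) :
    ∑ t ∈ Finset.Icc 1 T, ∫⁻ ω, ENNReal.ofReal ((fun p : Σ i, Fin (dz i) =>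
          X.estimate g p.1 t ω p.2 - X.linEst (F t) p.1 ω p.2) ⬝ᵥ (M.S *ᵥ fun p =>
          X.estimate g p.1 t ω p.2 - X.linEst (F t) p.1 ω p.2)) ∂μ = 0 ↔
      ∀ i t, 1 ≤ t → t ≤ T → ∀ᵐ ω ∂μ, X.estimate g i t ω = X.linEst (F t) i ω := by
  have hD : ∀ t, Measurable fun ω (p : Σ i, Fin (dz i)) =>
      X.estimate g p.1 t ω p.2 - X.linEst (F t) p.1 ω p.2 := fun t =>
    measurable_pi_lambda _ fun p => (measurable_pi_apply p.2).comp
      ((H.measurable_estimate g p.1 t).sub (H.measurable_linEst hG hn (F t) p.1))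
  rw [Finset.sum_eq_zero_iff]
  constructor
  · intro h i t h1 h2
    have h3 := (lintegral_eq_zero_iff
      (measurable_dotProduct_mulVec (hD t) (hD t)).ennreal_ofReal).1
      (h t (Finset.mem_Icc.2 ⟨h1, h2⟩))
    filter_upwards [h3] with ω hω
    have h4 := hS.eq_zero_of_dotProduct_eq_zero
      (le_antisymm (ENNReal.ofReal_eq_zero.1 hω) (hS.posSemidef.dotProduct_nonneg _))
    funext a
    exact sub_eq_zero.1 (congr_fun h4 ⟨i, a⟩)
  · intro h t ht
    rw [Finset.mem_Icc] at ht
    rw [lintegral_eq_zero_iff (measurable_dotProduct_mulVec (hD t) (hD t)).ennreal_ofReal]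
    filter_upwards [ae_all_iff.2 fun i => h i t ht.1 ht.2] with ω hω
    have h0 : (fun p : Σ i, Fin (dz i) =>
        X.estimate g p.1 t ω p.2 - X.linEst (F t) p.1 ω p.2) = 0 := by
      funext p
      rw [hω p.1]
      exact sub_self _
    simp [h0]

/-- The deviation costs are nonnegative, so the right-hand side is a lower bound, and the linear
strategy attains it with zero deviation. -/
lemma isMinimal_iff {T : ℕ} {F : (t : ℕ) → M.Gains t}
    (hF : ∀ t, 1 ≤ t → t ≤ T → X.GainEquations μ t (F t)) (g : M.Strategy) :
    (∀ g' : M.Strategy, X.J μ T g ≤ X.J μ T g') ↔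
      X.J μ T g = ENNReal.ofReal (∑ t ∈ Finset.Icc 1 T,
        ∫ ω, X.linErr (F t) ω ⬝ᵥ (M.S *ᵥ X.linErr (F t) ω) ∂μ) := by
  constructor
  · intro h
    obtain ⟨g₀, -, hg₀⟩ := exists_linear_strategy (X := X) hG hn F
    refine le_antisymm ((h g₀).trans_eq ?_) ?_
    · rw [H.J_eq_add hG hn hS hF, (H.sum_deviation_eq_zero_iff hG hn hS F g₀).2
        fun i t _ _ => Filter.Eventually.of_forall (hg₀ i t), add_zero]
    · rw [H.J_eq_add hG hn hS hF g]
      exact le_self_add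
  · intro h g'
    rw [h, H.J_eq_add hG hn hS hF g']
    exact le_self_add

end Primitives.IsGaussianModel

end

theorem theorem2 {n dx : ℕ} {dy dz : Fin n → ℕ} (hn : 2 ≤ n)
    (M : TeamModel n dx dy dz) (hG : M.G.StronglyConnected)
    {Ω : Type*} [MeasurableSpace Ω] (μ : Measure Ω) [IsProbabilityMeasure μ]
    (X : Primitives M Ω)
    -- the laws of the primitive random variables
    (hmeas : ∀ k, Measurable (X.toFamily k))
    (hx : μ.map (fun ω => WithLp.toLp 2 (X.x1 ω)) = multivariateGaussian 0 M.Sx)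
    (hw : ∀ t, 1 ≤ t → μ.map (fun ω => WithLp.toLp 2 (X.w t ω)) = multivariateGaussian 0 M.Q)
    (hv : ∀ i t, 1 ≤ t →
      μ.map (fun ω => WithLp.toLp 2 (X.v i t ω)) = multivariateGaussian 0 (M.R i))
    -- the assumptions on the weights, the covariances and the independence
    (A1 : M.S.PosDef)
    (A2R : ∀ i, (M.R i).PosDef) (A2Q : M.Q.PosSemidef) (A2x : M.Sx.PosSemidef)
    (A3 : iIndepFun X.toFamily μ)
    (T : ℕ) :
    -- the auxiliary variables and covariances have their meaning
    (∀ t, 1 ≤ t → t ≤ T →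
      (∀ i, M.G.common t ⊆ M.G.info t i) ∧
      X.xhat (M.G.delayedTime t) =ᵐ[μ] μ[X.x (M.G.delayedTime t) | X.commonSigma t] ∧
      X.xcom t =ᵐ[μ] μ[X.x t | X.commonSigma t] ∧
      (∀ i, X.locHat t i =ᵐ[μ] μ[X.locVec t i | X.commonSigma t]) ∧
      (∀ i ω, X.locTilde t i ω = M.Cloc t i *ᵥ X.xtilde t ω + X.wloc t i ω + X.vloc t i ω) ∧
      covMat μ (X.xtilde t) (X.xtilde t) = M.P (M.G.delayedTime t) ∧
      (∀ i j, covMat μ (X.locTilde t i) (X.locTilde t j) = X.SigmaHat μ t i j) ∧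
      (∀ i, covMat μ (X.x t) (X.locTilde t i) = X.ThetaHat μ t i) ∧
      covMat μ (fun ω => X.x t ω - X.xcom t ω) (fun ω => X.x t ω - X.xcom t ω) = X.P0 μ t) ∧
    ∃ F : (t : ℕ) → M.Gains t,
      -- the gains are the unique solution of the matrix equations, and `F(t) = Γ(t)⁻¹ η(t)`
      (∀ t, 1 ≤ t → t ≤ T →
        X.GainEquations μ t (F t) ∧
        (∀ F' : M.Gains t, X.GainEquations μ t F' → F' = F t) ∧
        IsUnit (X.Gam μ t).det ∧
        M.vecGains (F t) = (X.Gam μ t)⁻¹ *ᵥ X.eta μ t) ∧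
      -- some strategy with linear rules produces the estimates `L_i x̂^com(t) + F_i(t) Ĩ^loc_i(t)`
      (∃ g : M.Strategy,
        (∀ i t, IsLinearMap ℝ (g.rule i t)) ∧
        ∀ i t, 1 ≤ t → t ≤ T → ∀ ω,
          X.estimate g i t ω = M.L i *ᵥ X.xcom t ω + F t i *ᵥ X.locTilde t i ω) ∧
      -- a strategy is optimal if and only if it produces these estimates
      (∀ g : M.Strategy, (∀ g' : M.Strategy, X.J μ T g ≤ X.J μ T g') ↔
        ∀ i t, 1 ≤ t → t ≤ T → ∀ᵐ ω ∂μ,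
          X.estimate g i t ω = M.L i *ᵥ X.xcom t ω + F t i *ᵥ X.locTilde t i ω) ∧
      -- the minimum of the team mean-squared error
      (∀ g : M.Strategy, (∀ g' : M.Strategy, X.J μ T g ≤ X.J μ T g') →
        X.J μ T g ≠ ∞ ∧
        (X.J μ T g).toReal = ∑ t ∈ Finset.Icc 1 T,
          ((M.Lmatᵀ * M.S * M.Lmat * X.P0 μ t).trace
            - X.eta μ t ⬝ᵥ ((X.Gam μ t)⁻¹ *ᵥ X.eta μ t))) := by

  have H : X.IsGaussianModel μ := ⟨hmeas, hx, hw, hv, A2R, A2Q, A2x, A3⟩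
  refine ⟨fun t ht _ => ⟨hG.common_subset_info t, H.xhat_ae_eq_condExp hG hn t,
    H.xcom_ae_eq_condExp hG hn ht, H.locHat_ae_eq_condExp hG hn t,
    Primitives.locTilde_eq hG hn t, H.covMat_err (CommGraph.one_le_delayedTime t),
    H.covMat_locTilde hG hn t, H.covMat_x_locTilde hG hn ht, H.covMat_comErr ht⟩, ?_⟩
  have hdet := H.isUnit_det_Gam hG hn A1
  -- Invertibility of `Γ(t)` holds at every `t`, so the gains can be defined without regard to the
  -- horizon.
  choose F hF using fun t => TeamModel.vecGains_surjective ((X.Gam μ t)⁻¹ *ᵥ X.eta μ t)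
  have hgain : ∀ t, X.GainEquations μ t (F t) := fun t => by
    rw [H.gainEquations_iff hG hn, hF, Matrix.mulVec_mulVec,
      Matrix.mul_nonsing_inv _ (hdet t), Matrix.one_mulVec]
  have hF' : ∀ t, 1 ≤ t → t ≤ T → X.GainEquations μ t (F t) := fun t _ _ => hgain t
  refine ⟨F, fun t _ _ => ⟨hgain t, fun F' h => ?_, hdet t, hF t⟩, ?_, fun g => ?_, fun g hg => ?_⟩
  · refine TeamModel.vecGains_injective ?_
    rw [hF, ← (H.gainEquations_iff hG hn F').1 h, Matrix.mulVec_mulVec,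
      Matrix.nonsing_inv_mul _ (hdet t), Matrix.one_mulVec]
  · obtain ⟨g, hl, hg⟩ := Primitives.exists_linear_strategy (X := X) hG hn F
    exact ⟨g, hl, fun i t _ _ => hg i t⟩
  · rw [H.isMinimal_iff hG hn A1 hF', H.J_eq_add hG hn A1 hF' g]
    refine Iff.trans ?_ (H.sum_deviation_eq_zero_iff hG hn A1 F g)
    refine ⟨fun h => ?_, fun h => by rw [h, add_zero]⟩
    -- The optimal cost is finite and can be cancelled, leaving zero total deviation cost.
    exact (ENNReal.add_right_inj ENNReal.ofReal_ne_top).1 (h.trans (add_zero _).symm)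
  · rw [(H.isMinimal_iff hG hn A1 hF' g).1 hg]
    refine ⟨ENNReal.ofReal_ne_top, ?_⟩
    rw [ENNReal.toReal_ofReal (Finset.sum_nonneg fun t _ =>
      integral_nonneg fun ω => A1.posSemidef.dotProduct_nonneg _)]
    refine Finset.sum_congr rfl fun t ht => ?_
    rw [H.integral_linErr hG hn A1 (Finset.mem_Icc.1 ht).1 (hgain t), hF]
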